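/- Let $-1<q<1$ and write $(u)_n=\prod_{j=0}^{n-1}(1-uq^j)$, $(u)_\infty=\prod_{j\ge 0}(1-uq^j)$, $(u_1,\dots,u_k)_\infty=\prod_{i}(u_i)_\infty$, $[m]_q=1+q+\dots+q^{m-1}$, $[m]_q!=[1]_q\cdots[m]_q$ and $\binom{n}{k}_q=\frac{[n]_q!}{[n-k]_q!\,[k]_q!}$ for $0\le k\le n$. Let $h_n(x|q)$ be the continuous $q$-Hermite polynomials, $h_{-1}=0$, $h_0=1$, $h_{n+1}(x|q)=2x\,h_n(x|q)-(1-q^n)h_{n-1}(x|q)$, and put $$v(x|t)=1-2tx+t^2,\qquad l(x|t)=(1+t)^2-4tx^2,\qquad \varphi_h(x|t,q)=\sum_{j\ge 0}\frac{t^j}{(q)_j}h_j(x|q),$$ $$f_h(x|q)=\frac{2(q)_\infty\sqrt{1-x^2}}{\pi}\prod_{k=1}^{\infty}l(x|q^k).$$ For real or complex $a,b,c,d$ with $\max(|a|,|b|,|c|,|d|)<1$ let $$f_{AW}(x|a,b,c,d,q)=\frac{(ab,ac,ad,bc,bd,cd)_\infty}{(abcd)_\infty}\,f_h(x|q)\,\varphi_h(x|a,q)\,\varphi_h(x|b,q)\,\varphi_h(x|c,q)\,\varphi_h(x|d,q)$$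 be the Askey--Wilson density. Let $S^{(2)}_n(b,d|q)=\sum_{j=0}^n\frac{(q)_n}{(q)_j(q)_{n-j}}\,b^jd^{n-j}$ and $$\sigma^{(4)}_n(a,b,c,d|q)=\sum_{j=0}^n\binom{n}{j}_q\frac{(bd)_j}{(abcd)_j}\,S^{(2)}_{n-j}(b,d|q)\sum_{k=0}^j\binom{j}{k}_q(cb)_k\,a^k\,(ad)_{j-k}\,c^{j-k}.$$ Then for every $n\ge 0$ the function $h_n(x|q)f_{AW}(x|a,b,c,d,q)$ is integrable on $[-1,1]$ and $$\int_{-1}^1 h_n(x|q)\,f_{AW}(x|a,b,c,d,q)\,dx=\sigma_n^{(4)}(a,b,c,d|q).$$ In particular $\int_{-1}^1 f_{AW}(x|a,b,c,d,q)\,dx=1$. Moreover the integrand below is integrable on $[-1,1]$, and $$\frac1{2\pi}\int_{-1}^1\frac{1}{\sqrt{1-x^2}}\prod_{n\ge 0}\frac{l(x|q^n)}{v(x|aq^n)\,v(x|bq^n)\,v(x|cq^n)\,v(x|dq^n)}\,dx=\frac{(abcd)_\infty}{(q,ab,ac,ad,bc,bd,cd)_\infty}.$$ -/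

import Mathlib

open MeasureTheory

noncomputable section

namespace AskeyWilson

/-- The finite `q`-Pochhammer symbol `(a;q)_n = ∏_{j<n} (1 - a q^j)`. -/
def qPoch {K : Type*} [Field K] (a q : K) (n : ℕ) : K :=
  ∏ j ∈ Finset.range n, (1 - a * q ^ j)

/-- The infinite `q`-Pochhammer symbol `(a;q)_∞ = ∏_{j≥0} (1 - a q^j)`. -/
def qPochInf {𝕜 : Type*} [RCLike 𝕜] (a q : 𝕜) : 𝕜 :=
  ∏' j : ℕ, (1 - a * q ^ j)

/-- `[n]_q = 1 + q + ⋯ + q^{n-1}`. -/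
def qNum {K : Type*} [Field K] (q : K) (n : ℕ) : K :=
  ∑ j ∈ Finset.range n, q ^ j

/-- `[n]_q! = [1]_q [2]_q ⋯ [n]_q`. -/
def qFact {K : Type*} [Field K] (q : K) (n : ℕ) : K :=
  ∏ j ∈ Finset.range n, qNum q (j + 1)

/-- The `q`-binomial coefficient, equal to `0` for `k > n`. -/
def qBinom {K : Type*} [Field K] (q : K) (n k : ℕ) : K :=
  if k ≤ n then qFact q n / (qFact q (n - k) * qFact q k) else 0

/-- The continuous `q`-Hermite polynomial `h_n(x|q)`, given by
`h_{-1} = 0`, `h_0 = 1`, `h_{n+1} = 2 x h_n - (1 - q^n) h_{n-1}`. -/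
def qHermite (x q : ℝ) : ℕ → ℝ
  | 0 => 1
  | 1 => 2 * x
  | n + 2 => 2 * x * qHermite x q (n + 1) - (1 - q ^ (n + 1)) * qHermite x q n

/-- `v(x|t) = 1 - 2 t x + t²`. -/
def v {𝕜 : Type*} [RCLike 𝕜] (x : ℝ) (t : 𝕜) : 𝕜 := 1 - 2 * t * (x : 𝕜) + t ^ 2

/-- `l(x|a) = (1 + a)² - 4 a x²`. -/
def l (x a : ℝ) : ℝ := (1 + a) ^ 2 - 4 * a * x ^ 2

/-- The generating function `φ_h(x|t,q) = ∑_{j≥0} t^j h_j(x|q) / (q;q)_j`. -/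
def phiH {𝕜 : Type*} [RCLike 𝕜] (x : ℝ) (t : 𝕜) (q : ℝ) : 𝕜 :=
  ∑' j : ℕ, t ^ j / ((qPoch q q j : ℝ) : 𝕜) * ((qHermite x q j : ℝ) : 𝕜)

/-- The density `f_h(x|q)` that makes the continuous `q`-Hermite polynomials orthogonal. -/
def fH (x q : ℝ) : ℝ :=
  2 * qPochInf q q * Real.sqrt (1 - x ^ 2) / Real.pi * ∏' k : ℕ, l x (q ^ (k + 1))

/-- The product `(ab, ac, ad, bc, bd, cd; q)_∞`. -/
def pairProd {𝕜 : Type*} [RCLike 𝕜] (a b c d q : 𝕜) : 𝕜 :=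
  qPochInf (a * b) q * qPochInf (a * c) q * qPochInf (a * d) q *
    qPochInf (b * c) q * qPochInf (b * d) q * qPochInf (c * d) q

/-- The Askey–Wilson density `f_AW(x|a,b,c,d,q)`. -/
def fAW {𝕜 : Type*} [RCLike 𝕜] (x : ℝ) (a b c d : 𝕜) (q : ℝ) : 𝕜 :=
  pairProd a b c d (q : 𝕜) / qPochInf (a * b * c * d) (q : 𝕜) * ((fH x q : ℝ) : 𝕜) *
    phiH x a q * phiH x b q * phiH x c q * phiH x d q

/-- `S_n^{(2)}(a,b|q) = ∑_{j≤n} (q;q)_n / ((q;q)_j (q;q)_{n-j}) a^j b^{n-j}`. -/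
def S2 {K : Type*} [Field K] (a b q : K) (n : ℕ) : K :=
  ∑ j ∈ Finset.range (n + 1),
    qPoch q q n / (qPoch q q j * qPoch q q (n - j)) * a ^ j * b ^ (n - j)

/-- The function `σ_n^{(4)}(a,b,c,d|q)`. -/
def sigma4 {K : Type*} [Field K] (a b c d q : K) (n : ℕ) : K :=
  ∑ j ∈ Finset.range (n + 1),
    qBinom q n j * (qPoch (b * d) q j / qPoch (a * b * c * d) q j) * S2 b d q (n - j) *
      ∑ k ∈ Finset.range (j + 1),
        qBinom q j k * qPoch (c * b) q k * a ^ k * qPoch (a * d) q (j - k) * c ^ (j - k)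

/-- The integrand of the Askey–Wilson integral (without the factor `1 / (2π)`). -/
def awIntegrand {𝕜 : Type*} [RCLike 𝕜] (x : ℝ) (a b c d : 𝕜) (q : ℝ) : 𝕜 :=
  ((1 / Real.sqrt (1 - x ^ 2) : ℝ) : 𝕜) *
    ∏' n : ℕ, ((l x (q ^ n) : ℝ) : 𝕜) /
      (v x (a * (q : 𝕜) ^ n) * v x (b * (q : 𝕜) ^ n) *
        v x (c * (q : 𝕜) ^ n) * v x (d * (q : 𝕜) ^ n))

end AskeyWilson

end

/-!
The proof treats every integral against the Askey–Wilson density as a moment `∫ hₙ(x) g(x) dx` over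
`[-1, 1]`, and introduces the parameters one at a time, starting from `g = f_h` and multiplying by
one factor `φ_h(x|a)` per step.

*No parameter.* The moments of `f_h` are `δ_{n,0}` (`integral_qHermite_mul_fH`). At `x = cos θ` the
density becomes a multiple of `∏_{k ≥ 0} l(cos θ|qᵏ)`. Truncated at `k < N` this product is, up to a
constant, the weight of the Rogers polynomials of parameter `β = q ^ N`, and its moments have a
closed form (`truncMoment_eq`): it holds for `N = 0` by Fourier orthogonality, and passes from `N`
to `N + 1` because `4 x² hₙ` is a combination of `hₙ₊₂`, `hₙ`, `hₙ₋₂`. The factor `β ^ m` in the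
moment of `h_{2m}` sends it to `0` as `N → ∞` unless `m = 0`.

*One more parameter.* The `q`-difference equation `φ_h(x|aq) = v(x|a) φ_h(x|a)` (`phiH_mul_q`) and
the three-term recurrence of `hₙ` give a relation between the moments of `φ_h(·|a) g` for `a` and
`a q` (`moment_phiH_mul_q`). When `a ≠ 0` it expresses the moment of order `n + 1` by moments of
lower order, so the moments of `φ_h(·|a) g` are determined by their total mass, which is the sum
`∑ aʲ / (q)_j ∫ h_j g`, and by the case `a = 0`, which is the previous step (`moment_phiH_mul_eq`).

It remains to see that `(abcd)_∞ / (ab, …, cd)_∞ · σ⁽⁴⁾ₙ(a,b,c,d)` meets these requirements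
(`moment_phiH_mul_step`). The total mass comes from the `q`-binomial theorem (`tsum_qBinomial`),
as `σ⁽⁴⁾` is a plain convolution when its third parameter vanishes (`sigma4_third_zero`). The
contiguous relation in `a` (`sigma4_mul_q`) is an identity of formal power series: the generating
function of `σ⁽⁴⁾` is that of the Rogers–Szegő polynomials in `b, d` times that of `tau`, and the
relation for `tau` follows from contiguous relations of the inner sums of `σ⁽⁴⁾`.

The last integral is the total mass of the density, rewritten with the product formula
`φ_h(x|t) = ∏ 1 / v(x|t qᵏ)` (`hasProd_inv_v`).
-/

noncomputable section

namespace AskeyWilson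

open Filter Topology

/-! ### Finite `q`-Pochhammer symbols and `q`-exponential generating functions -/

lemma qPoch_zero {K : Type*} [Field K] (a q : K) : qPoch a q 0 = 1 := by simp [qPoch]

lemma qPoch_succ {K : Type*} [Field K] (a q : K) (n : ℕ) :
    qPoch a q (n + 1) = qPoch a q n * (1 - a * q ^ n) := by
  simp [qPoch, Finset.prod_range_succ]

lemma qPoch_succ' {K : Type*} [Field K] (a q : K) (n : ℕ) :
    qPoch a q (n + 1) = (1 - a) * qPoch (a * q) q n := by
  simp only [qPoch, Finset.prod_range_succ', pow_zero, mul_one, pow_succ]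
  rw [mul_comm]
  congr 1
  exact Finset.prod_congr rfl fun j _ => by ring

lemma one_sub_pow_succ_ne_zero {K : Type*} [Field K] {q : K} (hq : ∀ n, qPoch q q n ≠ 0) (n : ℕ) :
    1 - q ^ (n + 1) ≠ 0 := by
  have h := hq (n + 1)
  rw [qPoch_succ, ← pow_succ'] at h
  exact right_ne_zero_of_mul h

lemma qPoch_zero_left {K : Type*} [Field K] (q : K) (n : ℕ) : qPoch 0 q n = 1 := by simp [qPoch]

lemma qFact_mul_pow {K : Type*} [Field K] (q : K) (n : ℕ) :
    qFact q n * (1 - q) ^ n = qPoch q q n := by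
  induction n with
  | zero => simp [qFact, qPoch]
  | succ n ih =>
    rw [qPoch_succ, ← ih, qFact, Finset.prod_range_succ, ← qFact, qNum, pow_succ, ← pow_succ' q,
      ← geom_sum_mul_neg]
    ring

lemma qBinom_eq {K : Type*} [Field K] {q : K} (hq : ∀ n, qPoch q q n ≠ 0) {n k : ℕ} (hk : k ≤ n) :
    qBinom q n k = qPoch q q n / (qPoch q q k * qPoch q q (n - k)) := by
  have h1 : 1 - q ≠ 0 := by simpa using one_sub_pow_succ_ne_zero hq 0
  rw [qBinom, if_pos hk, ← qFact_mul_pow q n, ← qFact_mul_pow q k, ← qFact_mul_pow q (n - k)]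
  have h2 : (1 - q) ^ n = (1 - q) ^ k * (1 - q) ^ (n - k) := by
    rw [← pow_add, Nat.add_sub_cancel' hk]
  have h3 : qFact q k ≠ 0 := left_ne_zero_of_mul (qFact_mul_pow q k ▸ hq k)
  have h4 : qFact q (n - k) ≠ 0 := left_ne_zero_of_mul (qFact_mul_pow q (n - k) ▸ hq (n - k))
  rw [h2]
  field_simp

/-- The `q`-exponential generating function `∑ f_n Xⁿ / (q;q)_n` of a sequence. -/
def qgf {K : Type*} [Field K] (q : K) (f : ℕ → K) : PowerSeries K :=
  PowerSeries.mk fun n => f n / qPoch q q n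

lemma qgf_injective {K : Type*} [Field K] {q : K} (hq : ∀ n, qPoch q q n ≠ 0) {f g : ℕ → K}
    (h : qgf q f = qgf q g) (n : ℕ) : f n = g n := by
  have := congrArg (PowerSeries.coeff n) h
  simpa [qgf, div_left_inj' (hq n)] using this

lemma qgf_add {K : Type*} [Field K] (q : K) (f g : ℕ → K) :
    qgf q f + qgf q g = qgf q (fun n => f n + g n) := by
  ext n; simp [qgf, add_div]

lemma qgf_sub {K : Type*} [Field K] (q : K) (f g : ℕ → K) :
    qgf q f - qgf q g = qgf q (fun n => f n - g n) := by
  ext n; simp [qgf, sub_div]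

lemma C_mul_qgf {K : Type*} [Field K] (q a : K) (f : ℕ → K) :
    PowerSeries.C a * qgf q f = qgf q (fun n => a * f n) := by
  ext n; simp [qgf, mul_div_assoc]

lemma rescale_qgf {K : Type*} [Field K] (q : K) (f : ℕ → K) :
    PowerSeries.rescale q (qgf q f) = qgf q (fun n => q ^ n * f n) := by
  ext n; simp [qgf, mul_div_assoc]

lemma X_mul_qgf {K : Type*} [Field K] {q : K} (hq : ∀ n, qPoch q q n ≠ 0) (f : ℕ → K) :
    PowerSeries.X * qgf q f = qgf q (fun n => (1 - q ^ n) * f (n - 1)) := by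
  ext n
  cases n with
  | zero => simp [qgf]
  | succ n =>
    have := hq n
    have := one_sub_pow_succ_ne_zero hq n
    simp only [PowerSeries.coeff_succ_X_mul, qgf, PowerSeries.coeff_mk, qPoch_succ, ← pow_succ',
      Nat.add_sub_cancel]
    field_simp

/-- `(qgf f - qgf f (q X)) / X` is the generating function of the shifted sequence. -/
lemma X_mul_qgf_shift {K : Type*} [Field K] {q : K} (hq : ∀ n, qPoch q q n ≠ 0) (f : ℕ → K) :
    PowerSeries.X * qgf q (fun n => f (n + 1)) = qgf q f - PowerSeries.rescale q (qgf q f) := by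
  rw [X_mul_qgf hq, rescale_qgf, qgf_sub]
  congr 1
  ext n
  cases n <;> simp; ring

/-- The `q`-binomial convolution `∑ₖ [n, k]_q f_k g_{n-k}`. -/
def qConv {K : Type*} [Field K] (q : K) (f g : ℕ → K) (n : ℕ) : K :=
  ∑ k ∈ Finset.range (n + 1), qBinom q n k * f k * g (n - k)

lemma qConv_div {K : Type*} [Field K] {q : K} (hq : ∀ n, qPoch q q n ≠ 0) (f g : ℕ → K) (n : ℕ) :
    qConv q f g n / qPoch q q n =
      ∑ k ∈ Finset.range (n + 1), f k / qPoch q q k * (g (n - k) / qPoch q q (n - k)) := by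
  rw [qConv, Finset.sum_div]
  refine Finset.sum_congr rfl fun k hk => ?_
  rw [qBinom_eq hq (Nat.lt_succ_iff.1 (Finset.mem_range.1 hk))]
  have := hq n; have := hq k; have := hq (n - k)
  field_simp

lemma qgf_qConv {K : Type*} [Field K] {q : K} (hq : ∀ n, qPoch q q n ≠ 0) (f g : ℕ → K) :
    qgf q (qConv q f g) = qgf q f * qgf q g := by
  ext n
  rw [PowerSeries.coeff_mul, Finset.Nat.sum_antidiagonal_eq_sum_range_succ_mk]
  simp only [qgf, PowerSeries.coeff_mk]
  exact qConv_div hq f g n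

lemma qConv_comm {K : Type*} [Field K] {q : K} (hq : ∀ n, qPoch q q n ≠ 0) (f g : ℕ → K) (n : ℕ) :
    qConv q f g n = qConv q g f n :=
  qgf_injective hq (by rw [qgf_qConv hq, qgf_qConv hq, mul_comm]) n

lemma S2_eq_qConv {K : Type*} [Field K] {q : K} (hq : ∀ n, qPoch q q n ≠ 0) (a b : K) (n : ℕ) :
    S2 a b q n = qConv q (fun k => a ^ k) (fun k => b ^ k) n := by
  refine Finset.sum_congr rfl fun k hk => ?_
  rw [qBinom_eq hq (Nat.lt_succ_iff.1 (Finset.mem_range.1 hk))]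

/-! ### Contiguous relations for `σ⁽⁴⁾` -/

/-- The inner sum of `σ⁽⁴⁾`, the `q`-convolution of `(bc)_k a^k` and `(ad)_k c^k`. -/
def innerSum {K : Type*} [Field K] (a b c d q : K) (j : ℕ) : K :=
  qConv q (fun k => qPoch (c * b) q k * a ^ k) (fun k => qPoch (a * d) q k * c ^ k) j

lemma sigma4_eq_qConv {K : Type*} [Field K] (a b c d q : K) (n : ℕ) :
    sigma4 a b c d q n =
      qConv q (fun j => qPoch (b * d) q j / qPoch (a * b * c * d) q j * innerSum a b c d q j)
        (S2 b d q) n := by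
  refine Finset.sum_congr rfl fun j _ => ?_
  have : innerSum a b c d q j = ∑ k ∈ Finset.range (j + 1),
      qBinom q j k * qPoch (c * b) q k * a ^ k * qPoch (a * d) q (j - k) * c ^ (j - k) := by
    rw [innerSum, qConv]
    exact Finset.sum_congr rfl fun k _ => by ring
  simp only [this]
  ring

lemma innerSum_comm {K : Type*} [Field K] {q : K} (hq : ∀ n, qPoch q q n ≠ 0) (a b c d : K)
    (n : ℕ) : innerSum a b c d q n = innerSum c d a b q n :=
  qConv_comm hq _ _ n

lemma S2_comm {K : Type*} [Field K] {q : K} (hq : ∀ n, qPoch q q n ≠ 0) (a b : K) (n : ℕ) :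
    S2 a b q n = S2 b a q n := by
  rw [S2_eq_qConv hq, S2_eq_qConv hq, qConv_comm hq]

lemma sigma4_comm {K : Type*} [Field K] {q : K} (hq : ∀ n, qPoch q q n ≠ 0) (a b c d : K)
    (n : ℕ) : sigma4 a b c d q n = sigma4 c d a b q n := by
  simp only [sigma4_eq_qConv, qConv, innerSum_comm hq a b c d, S2_comm hq b d]
  rw [mul_comm b d, show a * b * c * d = c * d * a * b by ring]

/-- The `q`-difference equation of the generating function of `(bc)_k a^k`. -/
lemma one_sub_mul_qgf_qPoch {K : Type*} [Field K] {q : K} (hq : ∀ n, qPoch q q n ≠ 0) (u a : K) :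
    (1 - PowerSeries.C a * PowerSeries.X) * qgf q (fun k => qPoch u q k * a ^ k) =
      (1 - PowerSeries.C (u * a) * PowerSeries.X) *
        PowerSeries.rescale q (qgf q (fun k => qPoch u q k * a ^ k)) := by
  simp only [sub_mul, one_mul, mul_assoc, rescale_qgf, X_mul_qgf hq, C_mul_qgf, qgf_sub]
  congr 1
  ext n
  cases n with
  | zero => simp
  | succ n => simp only [Nat.add_sub_cancel, qPoch_succ]; ring

/-- Three-term recurrence of the inner sums. For `n = 0` the truncated index `n - 1` is harmless, as
its coefficient contains the factor `1 - q ^ n`; the same holds in all relations below. -/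
lemma innerSum_succ {K : Type*} [Field K] {q : K} (hq : ∀ n, qPoch q q n ≠ 0) (a b c d : K)
    (n : ℕ) :
    innerSum a b c d q (n + 1) =
      (a + c - a * c * (b + d) * q ^ n) * innerSum a b c d q n -
        a * c * (1 - q ^ n) * (1 - a * b * c * d * q ^ (n - 1)) * innerSum a b c d q (n - 1) := by
  have hG : qgf q (innerSum a b c d q) = qgf q (fun k => qPoch (c * b) q k * a ^ k) *
      qgf q (fun k => qPoch (a * d) q k * c ^ k) := qgf_qConv hq _ _
  have h1 := one_sub_mul_qgf_qPoch hq (c * b) a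
  have h2 := one_sub_mul_qgf_qPoch hq (a * d) c
  have h3 := X_mul_qgf_shift hq (innerSum a b c d q)
  have h4 : (1 - PowerSeries.C a * PowerSeries.X) * (1 - PowerSeries.C c * PowerSeries.X) *
      qgf q (innerSum a b c d q) =
      (1 - PowerSeries.C (c * b * a) * PowerSeries.X) *
      (1 - PowerSeries.C (a * d * c) * PowerSeries.X) *
      PowerSeries.rescale q (qgf q (innerSum a b c d q)) := by
    rw [hG, map_mul (PowerSeries.rescale q)]
    linear_combination (1 - PowerSeries.C c * PowerSeries.X) *
      qgf q (fun k => qPoch (a * d) q k * c ^ k) * h1 +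
      (1 - PowerSeries.C (c * b * a) * PowerSeries.X) *
        PowerSeries.rescale q (qgf q (fun k => qPoch (c * b) q k * a ^ k)) * h2
  -- `h4` expanded, with the common factor `X` of all remaining terms cancelled
  have h5 : qgf q (fun n => innerSum a b c d q (n + 1)) =
      PowerSeries.C (a + c) * qgf q (innerSum a b c d q)
        - PowerSeries.C (a * c) * (PowerSeries.X * qgf q (innerSum a b c d q))
        - PowerSeries.C (a * c * (b + d)) * PowerSeries.rescale q (qgf q (innerSum a b c d q))
        + PowerSeries.C (a * c * (a * b * c * d)) *
          (PowerSeries.X * PowerSeries.rescale q (qgf q (innerSum a b c d q))) := by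
    refine mul_left_cancel₀ (PowerSeries.X_ne_zero (R := K)) ?_
    rw [h3]
    simp only [map_mul, map_add] at h4 ⊢
    linear_combination h4
  simp only [rescale_qgf, X_mul_qgf hq, C_mul_qgf, qgf_sub, qgf_add] at h5
  rw [qgf_injective hq h5 n]
  ring

/-- Contiguous relation of the inner sums under `a ↦ a q`, valid term by term. -/
lemma innerSum_mul_q {K : Type*} [Field K] {q : K} (hq : ∀ n, qPoch q q n ≠ 0) (a b c d : K)
    (n : ℕ) :
    innerSum (a * q) b c d q (n + 1) =
      q ^ (n + 1) * innerSum a b c d q (n + 1) +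
        c * (1 - q ^ (n + 1)) * innerSum (a * q) b c d q n := by
  rw [innerSum, innerSum, innerSum, qConv, qConv, qConv, Finset.sum_range_succ,
    Finset.sum_range_succ _ (n + 1), mul_add, Finset.mul_sum, Finset.mul_sum]
  rw [add_right_comm, ← Finset.sum_add_distrib]
  congr 1
  · refine Finset.sum_congr rfl fun k hk => ?_
    have hk := Nat.lt_succ_iff.1 (Finset.mem_range.1 hk)
    rw [qBinom_eq hq hk, qBinom_eq hq (hk.trans n.le_succ)]
    obtain ⟨m, rfl⟩ := Nat.exists_eq_add_of_le hk
    rw [show k + m + 1 - k = m + 1 by omega, show k + m - k = m by omega]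
    rw [qPoch_succ' (a * d), qPoch_succ q q (k + m), qPoch_succ q q m, ← pow_succ', ← pow_succ',
      qPoch_succ (a * q * d), show a * d * q = a * q * d by ring]
    have := hq k; have := hq m; have := one_sub_pow_succ_ne_zero hq m
    field_simp
    ring
  · simp only [Nat.sub_self, qPoch_zero, pow_zero, mul_one, mul_pow]; ring

lemma innerSum_zero {K : Type*} [Field K] {q : K} (hq : ∀ n, qPoch q q n ≠ 0) (a b c d : K) :
    innerSum a b c d q 0 = 1 := by
  simp [innerSum, qConv, qPoch_zero, qBinom_eq hq]

/-- Two-term expression of the inner sum at `a q` by the ones at `a`. Eliminating the inner sums of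
order `n - 1` from this and the three-term recurrence gives the next case. -/
lemma mul_innerSum_mul_q {K : Type*} [Field K] {q : K} (hq : ∀ n, qPoch q q n ≠ 0) (a b c d : K)
    (n : ℕ) :
    (1 - a * b) * (1 - a * d) * innerSum (a * q) b c d q n =
      (1 - a * (b + d) * q ^ n + a ^ 2 * b * d * q ^ n) * innerSum a b c d q n -
        a * (1 - q ^ n) * (1 - a * b * c * d * q ^ (n - 1)) * innerSum a b c d q (n - 1) := by
  induction n with
  | zero => simp [innerSum_zero hq]; ring
  | succ n ih =>
    rw [innerSum_mul_q hq]
    have h := innerSum_succ hq a b c d n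
    simp only [Nat.add_sub_cancel]
    linear_combination c * (1 - q ^ (n + 1)) * ih - (1 - q ^ (n + 1)) * h

/-- The coefficient of `σ⁽⁴⁾` in its expansion over Rogers–Szegő polynomials in `b, d`. -/
def tau {K : Type*} [Field K] (a b c d q : K) (j : ℕ) : K :=
  qPoch (b * d) q j / qPoch (a * b * c * d) q j * innerSum a b c d q j

lemma tau_mul_q {K : Type*} [Field K] {q : K} (hq : ∀ n, qPoch q q n ≠ 0) (a b c d : K)
    (hP : ∀ n, 1 - a * b * c * d * q ^ n ≠ 0) (n : ℕ) :
    (1 - a * b) * (1 - a * c) * (1 - a * d) / (1 - a * b * c * d) * tau (a * q) b c d q n =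
      -a * tau a b c d q (n + 1) + (1 + a ^ 2 - a * (b + d) * q ^ n) * tau a b c d q n -
        a * (1 - q ^ n) * (1 - b * d * q ^ (n - 1)) * tau a b c d q (n - 1) := by
  have hP0 : 1 - a * b * c * d ≠ 0 := by simpa using hP 0
  have hPn : ∀ n, qPoch (a * b * c * d) q n ≠ 0 := fun n => Finset.prod_ne_zero_iff.2 fun j _ => hP j
  have hB := mul_innerSum_mul_q hq a b c d n
  have h3 := innerSum_succ hq a b c d n
  have hs : qPoch (a * b * c * d) q n * (1 - a * b * c * d * q ^ n) =
      (1 - a * b * c * d) * qPoch (a * q * b * c * d) q n := by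
    rw [← qPoch_succ, qPoch_succ', show a * b * c * d * q = a * q * b * c * d by ring]
  have hQ : qPoch (a * q * b * c * d) q n =
      qPoch (a * b * c * d) q n * (1 - a * b * c * d * q ^ n) / (1 - a * b * c * d) := by
    rw [hs]; field_simp
  have e1 : (1 - a * b) * (1 - a * c) * (1 - a * d) / (1 - a * b * c * d) * tau (a * q) b c d q n =
      (1 - a * c) * (qPoch (b * d) q n / qPoch (a * b * c * d) q n) /
        (1 - a * b * c * d * q ^ n) * ((1 - a * b) * (1 - a * d) * innerSum (a * q) b c d q n) := by
    have := hP n; have := hPn n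
    rw [tau, hQ]
    field_simp
  rw [e1, hB, tau, tau, tau, h3]
  cases n with
  | zero =>
    have := hP 0
    simp only [pow_zero, mul_one] at this
    simp [qPoch_succ, qPoch_zero, innerSum_zero hq]
    generalize hD : 1 - a * b * c * d = D at *
    field_simp
    rw [← hD]
    ring
  | succ m =>
    have h4 := hP m
    have h5 := hP (m + 1)
    have h6 := hPn m
    simp only [qPoch_succ, Nat.add_sub_cancel]
    generalize hD : 1 - a * b * c * d * q ^ m = D at *
    generalize hE : 1 - a * b * c * d * q ^ (m + 1) = E at *
    generalize qPoch (a * b * c * d) q m = w at *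
    field_simp
    rw [← hD, ← hE]
    ring

/-- The generating function of Rogers–Szegő polynomials is a product of two `q`-exponentials. -/
lemma rescale_qgf_S2 {K : Type*} [Field K] {q : K} (hq : ∀ n, qPoch q q n ≠ 0) (b d : K) :
    PowerSeries.rescale q (qgf q (S2 b d q)) =
      (1 - PowerSeries.C b * PowerSeries.X) * (1 - PowerSeries.C d * PowerSeries.X) *
        qgf q (S2 b d q) := by
  have hS : qgf q (S2 b d q) = qgf q (fun k => b ^ k) * qgf q (fun k => d ^ k) := by
    rw [← qgf_qConv hq]; congr 1; ext n; exact S2_eq_qConv hq b d n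
  have h (a : K) : (1 - PowerSeries.C a * PowerSeries.X) * qgf q (fun k => a ^ k) =
      PowerSeries.rescale q (qgf q (fun k => a ^ k)) := by
    simpa [qPoch_zero_left] using one_sub_mul_qgf_qPoch hq 0 a
  rw [hS, map_mul, ← h, ← h]
  ring

/-- The contiguous relation of `σ⁽⁴⁾` in its first parameter. It has the shape of the relation
satisfied by the moments `∫ hₙ φ_a g`. -/
lemma sigma4_mul_q {K : Type*} [Field K] {q : K} (hq : ∀ n, qPoch q q n ≠ 0) (a b c d : K)
    (hP : ∀ n, 1 - a * b * c * d * q ^ n ≠ 0) (n : ℕ) :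
    (1 - a * b) * (1 - a * c) * (1 - a * d) / (1 - a * b * c * d) * sigma4 (a * q) b c d q n =
      (1 + a ^ 2) * sigma4 a b c d q n - a * sigma4 a b c d q (n + 1) -
        a * (1 - q ^ n) * sigma4 a b c d q (n - 1) := by
  set lam := (1 - a * b) * (1 - a * c) * (1 - a * d) / (1 - a * b * c * d) with hlam
  have hS (a : K) : qgf q (sigma4 a b c d q) = qgf q (tau a b c d q) * qgf q (S2 b d q) := by
    rw [← qgf_qConv hq]; congr 1; ext n; exact sigma4_eq_qConv a b c d q n
  have hE := rescale_qgf_S2 hq b d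
  have h1 := X_mul_qgf_shift hq (sigma4 a b c d q)
  have h2 := X_mul_qgf_shift hq (tau a b c d q)
  have hT : PowerSeries.C lam * qgf q (tau (a * q) b c d q) =
      PowerSeries.C (-a) * qgf q (fun n => tau a b c d q (n + 1))
        + PowerSeries.C (1 + a ^ 2) * qgf q (tau a b c d q)
        - PowerSeries.C (a * (b + d)) * PowerSeries.rescale q (qgf q (tau a b c d q))
        - PowerSeries.C a * (PowerSeries.X * qgf q (tau a b c d q))
        + PowerSeries.C (a * b * d) *
          (PowerSeries.X * PowerSeries.rescale q (qgf q (tau a b c d q))) := by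
    simp only [rescale_qgf, X_mul_qgf hq, C_mul_qgf, qgf_sub, qgf_add]
    congr 1
    ext n
    rw [tau_mul_q hq a b c d hP]
    ring
  have hF : PowerSeries.C lam * qgf q (sigma4 (a * q) b c d q) =
      PowerSeries.C (1 + a ^ 2) * qgf q (sigma4 a b c d q)
        - PowerSeries.C a * qgf q (fun n => sigma4 a b c d q (n + 1))
        - PowerSeries.C a * (PowerSeries.X * qgf q (sigma4 a b c d q)) := by
    refine mul_left_cancel₀ (PowerSeries.X_ne_zero (R := K)) ?_
    rw [hS, map_mul, hE] at h1
    rw [hS, hS]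
    simp only [map_mul, map_add, map_neg, map_one, map_pow] at hT ⊢
    linear_combination PowerSeries.X * qgf q (S2 b d q) * hT
      - PowerSeries.C a * qgf q (S2 b d q) * h2 + PowerSeries.C a * h1
  simp only [X_mul_qgf hq, C_mul_qgf, qgf_sub] at hF
  rw [qgf_injective hq hF n]
  ring

lemma sigma4_zero {K : Type*} [Field K] {q : K} (hq : ∀ n, qPoch q q n ≠ 0) (a b c d : K) :
    sigma4 a b c d q 0 = 1 := by
  simp [sigma4, S2, qPoch_zero, qBinom_eq hq]

/-- With `c = 0` the inner sums are pure powers, so `σ⁽⁴⁾` is a single convolution. -/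
lemma sigma4_third_zero {K : Type*} [Field K] {q : K} (hq : ∀ n, qPoch q q n ≠ 0) (a b d : K)
    (n : ℕ) : sigma4 a b 0 d q n = qConv q (fun j => qPoch (b * d) q j * a ^ j) (S2 b d q) n := by
  have h (j : ℕ) : innerSum a b 0 d q j = a ^ j := by
    rw [innerSum, qConv, Finset.sum_range_succ, Finset.sum_eq_zero]
    · simp [qPoch_zero_left, qBinom_eq hq, qPoch_zero, div_self (hq j)]
    · intro k hk
      have : j - k ≠ 0 := by have := Finset.mem_range.1 hk; omega
      simp [this]
  simp only [sigma4_eq_qConv, h]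
  simp [qPoch_zero_left]

lemma S2_succ {K : Type*} [Field K] {q : K} (hq : ∀ n, qPoch q q n ≠ 0) (a b : K) (n : ℕ) :
    S2 a b q (n + 1) = (a + b) * S2 a b q n - a * b * (1 - q ^ n) * S2 a b q (n - 1) := by
  have h (j : ℕ) : innerSum a 0 b 0 q j = S2 a b q j := by
    simp [S2_eq_qConv hq, innerSum, qPoch_zero_left]
  simpa [h] using innerSum_succ hq a 0 b 0 n

lemma S2_zero {K : Type*} [Field K] (q a b : K) : S2 a b q 0 = 1 := by simp [S2, qPoch_zero]

lemma qConv_zero_pow {K : Type*} [Field K] {q : K} (hq : ∀ n, qPoch q q n ≠ 0) (u : ℕ → K)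
    (hu : u 0 = 1) (f : ℕ → K) (n : ℕ) : qConv q (fun j => u j * 0 ^ j) f n = f n := by
  rw [qConv, Finset.sum_eq_single 0]
  · simp [hu, qBinom_eq hq, qPoch_zero, div_self (hq n)]
  · intro j _ hj; simp [hj]
  · simp

lemma sigma4_first_third_zero {K : Type*} [Field K] {q : K} (hq : ∀ n, qPoch q q n ≠ 0) (b d : K)
    (n : ℕ) : sigma4 0 b 0 d q n = S2 b d q n := by
  rw [sigma4_third_zero hq, qConv_zero_pow hq _ (qPoch_zero _ _)]

lemma sigma4_second_third_zero {K : Type*} [Field K] {q : K} (hq : ∀ n, qPoch q q n ≠ 0)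
    (a d : K) (n : ℕ) : sigma4 a 0 0 d q n = S2 a d q n := by
  have h (j : ℕ) : S2 0 d q j = d ^ j := by
    rw [S2_eq_qConv hq]
    simpa using qConv_zero_pow hq (fun _ => 1) rfl (fun k => d ^ k) j
  rw [sigma4_third_zero hq, S2_eq_qConv hq]
  simp [qPoch_zero_left, qConv, h]

/-! ### Infinite `q`-Pochhammer symbols and the `q`-binomial theorem -/

lemma one_sub_ne_zero_of_norm_lt_one {𝕜 : Type*} [RCLike 𝕜] {u : 𝕜} (hu : ‖u‖ < 1) : 1 - u ≠ 0 := by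
  intro h
  rw [← sub_eq_zero.1 h, norm_one] at hu
  exact lt_irrefl _ hu

lemma norm_mul_lt_one {𝕜 : Type*} [RCLike 𝕜] {u w : 𝕜} (hu : ‖u‖ < 1) (hw : ‖w‖ < 1) :
    ‖u * w‖ < 1 := by
  rw [norm_mul]
  exact mul_lt_one_of_nonneg_of_lt_one_left (norm_nonneg _) hu hw.le

lemma norm_mul_pow_lt_one {𝕜 : Type*} [RCLike 𝕜] {u q : 𝕜} (hu : ‖u‖ < 1) (hq : ‖q‖ < 1) (n : ℕ) :
    ‖u * q ^ n‖ < 1 := by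
  rw [norm_mul, norm_pow]
  exact mul_lt_one_of_nonneg_of_lt_one_left (norm_nonneg _) hu (pow_le_one₀ (norm_nonneg _) hq.le)

lemma one_sub_mul_pow_ne_zero {𝕜 : Type*} [RCLike 𝕜] {u q : 𝕜} (hu : ‖u‖ < 1) (hq : ‖q‖ < 1)
    (n : ℕ) : 1 - u * q ^ n ≠ 0 :=
  one_sub_ne_zero_of_norm_lt_one (norm_mul_pow_lt_one hu hq n)

lemma qPoch_ne_zero {𝕜 : Type*} [RCLike 𝕜] {u q : 𝕜} (hu : ‖u‖ < 1) (hq : ‖q‖ < 1) (n : ℕ) :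
    qPoch u q n ≠ 0 :=
  Finset.prod_ne_zero_iff.2 fun j _ => one_sub_mul_pow_ne_zero hu hq j

lemma summable_norm_mul_pow {𝕜 : Type*} [RCLike 𝕜] (u : 𝕜) {q : 𝕜} (hq : ‖q‖ < 1) :
    Summable fun n : ℕ => ‖-(u * q ^ n)‖ := by
  simpa [norm_mul, norm_pow] using (summable_geometric_of_lt_one (norm_nonneg q) hq).mul_left ‖u‖

lemma tendsto_qPoch {𝕜 : Type*} [RCLike 𝕜] (u : 𝕜) {q : 𝕜} (hq : ‖q‖ < 1) :
    Tendsto (qPoch u q) atTop (𝓝 (qPochInf u q)) := by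
  simpa only [← sub_eq_add_neg, qPochInf] using!
    (multipliable_one_add_of_summable (summable_norm_mul_pow u hq)).tendsto_prod_tprod_nat

lemma qPochInf_ne_zero {𝕜 : Type*} [RCLike 𝕜] {u q : 𝕜} (hu : ‖u‖ < 1) (hq : ‖q‖ < 1) :
    qPochInf u q ≠ 0 := by
  have := tprod_one_add_ne_zero_of_summable (f := fun n : ℕ => -(u * q ^ n))
    (fun n => by simpa only [← sub_eq_add_neg] using one_sub_mul_pow_ne_zero hu hq n)
    (summable_norm_mul_pow u hq)
  simpa only [← sub_eq_add_neg, qPochInf] using this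

lemma qPochInf_zero {𝕜 : Type*} [RCLike 𝕜] (q : 𝕜) : qPochInf 0 q = 1 := by simp [qPochInf]

lemma qPochInf_eq_one_sub_mul {𝕜 : Type*} [RCLike 𝕜] (u : 𝕜) {q : 𝕜} (hq : ‖q‖ < 1) :
    qPochInf u q = (1 - u) * qPochInf (u * q) q := by
  refine tendsto_nhds_unique ((tendsto_add_atTop_iff_nat 1).2 (tendsto_qPoch u hq)) ?_
  exact ((tendsto_qPoch (u * q) hq).const_mul (1 - u)).congr fun n => (qPoch_succ' u q n).symm

lemma ofReal_qPoch {𝕜 : Type*} [RCLike 𝕜] (u q : ℝ) (n : ℕ) :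
    ((qPoch u q n : ℝ) : 𝕜) = qPoch (u : 𝕜) (q : 𝕜) n := by
  simp [qPoch]

lemma norm_ofReal_lt_one {𝕜 : Type*} [RCLike 𝕜] {q : ℝ} (hq : |q| < 1) : ‖(q : 𝕜)‖ < 1 := by
  simpa using hq

lemma ofReal_qPochInf {𝕜 : Type*} [RCLike 𝕜] (u : ℝ) {q : ℝ} (hq : |q| < 1) :
    ((qPochInf u q : ℝ) : 𝕜) = qPochInf (u : 𝕜) (q : 𝕜) := by
  refine tendsto_nhds_unique ?_ (tendsto_qPoch (u : 𝕜) (norm_ofReal_lt_one hq))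
  exact ((RCLike.continuous_ofReal.tendsto _).comp (tendsto_qPoch u (by simpa using hq))).congr
    fun n => ofReal_qPoch u q n

lemma exists_norm_le_of_tendsto {𝕜 : Type*} [RCLike 𝕜] {f : ℕ → 𝕜} {a : 𝕜}
    (h : Tendsto f atTop (𝓝 a)) : ∃ M : ℝ, 0 < M ∧ ∀ n, ‖f n‖ ≤ M := by
  obtain ⟨M, hM⟩ := h.norm.bddAbove_range
  exact ⟨max M 1, by positivity, fun n => (hM ⟨n, rfl⟩).trans (le_max_left _ _)⟩

lemma exists_norm_qPoch_inv_le {𝕜 : Type*} [RCLike 𝕜] {q : 𝕜} (hq : ‖q‖ < 1) :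
    ∃ M : ℝ, 0 < M ∧ ∀ n, ‖(qPoch q q n)⁻¹‖ ≤ M :=
  exists_norm_le_of_tendsto ((tendsto_qPoch q hq).inv₀ (qPochInf_ne_zero hq hq))

/-- Continuity at `0` of a power series, along the sequence `q ^ N`. -/
lemma tendsto_tsum_mul_pow_pow {𝕜 : Type*} [RCLike 𝕜] {f : ℕ → 𝕜} (hf : Summable fun n => ‖f n‖)
    {q : 𝕜} (hq : ‖q‖ < 1) :
    Tendsto (fun N : ℕ => ∑' n, f n * (q ^ N) ^ n) atTop (𝓝 (f 0)) := by
  have h0 : f 0 = ∑' n, if n = 0 then f n else 0 := by simp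
  rw [h0]
  refine tendsto_tsum_of_dominated_convergence hf (fun n => ?_) (Eventually.of_forall fun N n => ?_)
  · by_cases hn : n = 0
    · simp [hn]
    · simp only [hn, if_false, ← pow_mul']
      rw [← mul_zero (f n)]
      refine Tendsto.const_mul _ ?_
      simp only [pow_mul]
      exact tendsto_pow_atTop_nhds_zero_of_norm_lt_one
        (by rw [norm_pow]; exact pow_lt_one₀ (norm_nonneg _) hq hn)
  · rw [norm_mul]
    refine mul_le_of_le_one_right (norm_nonneg _) ?_
    simp only [norm_pow]
    exact pow_le_one₀ (by positivity) (pow_le_one₀ (norm_nonneg _) hq.le)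

lemma summable_norm_qBinomial {𝕜 : Type*} [RCLike 𝕜] (u : 𝕜) {z q : 𝕜} (hq : ‖q‖ < 1)
    (hz : ‖z‖ < 1) : Summable fun j => ‖qPoch u q j * z ^ j / qPoch q q j‖ := by
  obtain ⟨M, hM, h1⟩ := exists_norm_qPoch_inv_le hq
  obtain ⟨M', hM', h2⟩ := exists_norm_le_of_tendsto (tendsto_qPoch u hq)
  refine Summable.of_nonneg_of_le (fun _ => norm_nonneg _) (fun j => ?_)
    ((summable_geometric_of_lt_one (norm_nonneg z) hz).mul_left (M' * M))
  rw [div_eq_mul_inv, norm_mul, norm_mul, norm_pow]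
  calc _ ≤ M' * ‖z‖ ^ j * M := by gcongr; exacts [h2 j, h1 j]
    _ = _ := by ring

/-- The `q`-binomial theorem. -/
theorem tsum_qBinomial {𝕜 : Type*} [RCLike 𝕜] (u : 𝕜) {z q : 𝕜} (hq : ‖q‖ < 1)
    (hz : ‖z‖ < 1) :
    ∑' j, qPoch u q j * z ^ j / qPoch q q j = qPochInf (u * z) q / qPochInf z q := by
  -- `F` satisfies `(1 - z) F(z) = (1 - u z) F(q z)`, which is iterated down to `F(0) = 1`
  set F : 𝕜 → 𝕜 := fun z => ∑' j, qPoch u q j * z ^ j / qPoch q q j with hF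
  have hs (w : 𝕜) (hw : ‖w‖ < 1) : Summable fun j => qPoch u q j * w ^ j / qPoch q q j :=
    (summable_norm_qBinomial u hq hw).of_norm
  have step (w : 𝕜) (hw : ‖w‖ < 1) : (1 - w) * F w = (1 - u * w) * F (w * q) := by
    have hwq : ‖w * q‖ < 1 := norm_mul_lt_one hw hq
    have e : F w - F (w * q) = w * F w - u * w * F (w * q) := by
      simp only [hF]
      rw [← (hs w hw).tsum_sub (hs _ hwq), ← tsum_mul_left, ← tsum_mul_left,
        ← ((hs w hw).mul_left w).tsum_sub ((hs _ hwq).mul_left (u * w)),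
        ((hs w hw).sub (hs _ hwq)).tsum_eq_zero_add]
      simp only [pow_zero, sub_self, zero_add]
      refine tsum_congr fun j => ?_
      have := qPoch_ne_zero hq hq j
      have := one_sub_mul_pow_ne_zero hq hq j
      rw [qPoch_succ, qPoch_succ]
      generalize hD : 1 - q * q ^ j = D at *
      field_simp
      rw [← hD]
      ring
    linear_combination e
  have iter (N : ℕ) : qPoch z q N * F z = qPoch (u * z) q N * F (z * q ^ N) := by
    induction N with
    | zero => simp [qPoch_zero]
    | succ N ih =>
      have := step (z * q ^ N) (norm_mul_pow_lt_one hz hq N)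
      rw [qPoch_succ, qPoch_succ, pow_succ, ← mul_assoc z]
      linear_combination (1 - z * q ^ N) * ih + qPoch (u * z) q N * this
  have lim : Tendsto (fun N : ℕ => F (z * q ^ N)) atTop (𝓝 1) := by
    have := tendsto_tsum_mul_pow_pow (summable_norm_qBinomial u hq hz) hq
    simp only [qPoch_zero, pow_zero, mul_one, div_one] at this
    refine this.congr fun N => tsum_congr fun j => ?_
    rw [mul_pow]; ring
  have := tendsto_nhds_unique ((tendsto_qPoch z hq).mul_const (F z))
    (((tendsto_qPoch (u * z) hq).mul lim).congr fun N => (iter N).symm)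
  rw [eq_div_iff (qPochInf_ne_zero hz hq), mul_comm, this, mul_one]

/-- Generating functions of `q`-convolutions multiply. -/
lemma tsum_qConv {𝕜 : Type*} [RCLike 𝕜] {c q : 𝕜} (hq : ‖q‖ < 1) {f g : ℕ → 𝕜}
    (hf : Summable fun j => ‖f j * c ^ j / qPoch q q j‖)
    (hg : Summable fun j => ‖g j * c ^ j / qPoch q q j‖) :
    (Summable fun j => ‖qConv q f g j * c ^ j / qPoch q q j‖) ∧
    ∑' j, qConv q f g j * c ^ j / qPoch q q j =
      (∑' j, f j * c ^ j / qPoch q q j) * ∑' j, g j * c ^ j / qPoch q q j := by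
  have key (n : ℕ) : qConv q f g n * c ^ n / qPoch q q n =
      ∑ k ∈ Finset.range (n + 1), f k * c ^ k / qPoch q q k *
        (g (n - k) * c ^ (n - k) / qPoch q q (n - k)) := by
    rw [mul_div_right_comm, qConv_div (qPoch_ne_zero hq hq), Finset.sum_mul]
    refine Finset.sum_congr rfl fun k hk => ?_
    have : c ^ n = c ^ k * c ^ (n - k) := by
      rw [← pow_add, Nat.add_sub_cancel' (Nat.lt_succ_iff.1 (Finset.mem_range.1 hk))]
    rw [this]; ring
  have h1 := summable_norm_sum_mul_range_of_summable_norm hf hg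
  have h2 := tsum_mul_tsum_eq_tsum_sum_range_of_summable_norm hf hg
  exact ⟨h1.congr fun n => by rw [key], by rw [h2]; exact tsum_congr key⟩

lemma tsum_S2 {𝕜 : Type*} [RCLike 𝕜] {b d c q : 𝕜} (hq : ‖q‖ < 1)
    (hb : ‖b‖ < 1) (hd : ‖d‖ < 1) (hc : ‖c‖ < 1) :
    (Summable fun j => ‖S2 b d q j * c ^ j / qPoch q q j‖) ∧
    ∑' j, S2 b d q j * c ^ j / qPoch q q j = 1 / (qPochInf (b * c) q * qPochInf (d * c) q) := by
  have hs (b : 𝕜) (hb : ‖b‖ < 1) : Summable fun j => ‖b ^ j * c ^ j / qPoch q q j‖ := by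
    simpa only [qPoch_zero_left, one_mul, mul_pow] using
      summable_norm_qBinomial 0 hq (norm_mul_lt_one hb hc)
  have ht (b : 𝕜) (hb : ‖b‖ < 1) :
      ∑' j, b ^ j * c ^ j / qPoch q q j = 1 / qPochInf (b * c) q := by
    have := tsum_qBinomial 0 hq (norm_mul_lt_one hb hc)
    simpa only [qPoch_zero_left, one_mul, zero_mul, mul_pow, qPochInf_zero] using this
  simp only [S2_eq_qConv (qPoch_ne_zero hq hq)]
  refine ⟨(tsum_qConv hq (hs b hb) (hs d hd)).1, ?_⟩
  rw [(tsum_qConv hq (hs b hb) (hs d hd)).2, ht b hb, ht d hd]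
  ring

lemma tsum_sigma4_third_zero {𝕜 : Type*} [RCLike 𝕜] {a b c d q : 𝕜} (hq : ‖q‖ < 1)
    (ha : ‖a‖ < 1) (hb : ‖b‖ < 1) (hc : ‖c‖ < 1) (hd : ‖d‖ < 1) :
    ∑' j, sigma4 a b 0 d q j * c ^ j / qPoch q q j =
      qPochInf (a * b * c * d) q /
        (qPochInf (a * c) q * qPochInf (b * c) q * qPochInf (c * d) q) := by
  have hac := norm_mul_lt_one ha hc
  have h1 : Summable fun j => ‖qPoch (b * d) q j * a ^ j * c ^ j / qPoch q q j‖ := by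
    simpa only [mul_pow, mul_assoc] using summable_norm_qBinomial (b * d) hq hac
  have h2 : ∑' j, qPoch (b * d) q j * a ^ j * c ^ j / qPoch q q j =
      qPochInf (a * b * c * d) q / qPochInf (a * c) q := by
    have := tsum_qBinomial (b * d) hq hac
    simp only [mul_pow, ← mul_assoc] at this
    rw [this]
    congr 2
    ring
  obtain ⟨h3, h4⟩ := tsum_S2 hq hb hd hc
  simp only [sigma4_third_zero (qPoch_ne_zero hq hq)]
  rw [(tsum_qConv hq h1 h3).2, h2, h4, mul_comm d c]
  have := qPochInf_ne_zero hac hq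
  have := qPochInf_ne_zero (norm_mul_lt_one hb hc) hq
  have := qPochInf_ne_zero (norm_mul_lt_one hc hd) hq
  field_simp

/-! ### Continuous `q`-Hermite polynomials and their generating function -/

lemma qHermite_succ (x q : ℝ) (n : ℕ) :
    qHermite x q (n + 1) = 2 * x * qHermite x q n - (1 - q ^ n) * qHermite x q (n - 1) := by
  cases n <;> simp [qHermite]

/-- At `x = cos θ` the continuous `q`-Hermite polynomial is a Rogers–Szegő polynomial in
`exp (± i θ)`: both sides satisfy the same three-term recurrence. -/
lemma qHermite_cos {q : ℝ} (hq : |q| < 1) (θ : ℝ) (n : ℕ) :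
    ((qHermite (Real.cos θ) q n : ℝ) : ℂ) =
      S2 (Complex.exp (θ * Complex.I)) (Complex.exp (-θ * Complex.I)) (q : ℂ) n := by
  have hq' : ∀ n, qPoch (q : ℂ) q n ≠ 0 :=
    qPoch_ne_zero (norm_ofReal_lt_one hq) (norm_ofReal_lt_one hq)
  induction n using Nat.strong_induction_on with
  | _ n ih =>
    rcases n with _ | n
    · simp [qHermite, S2_zero]
    · rw [S2_succ hq', ← ih n (by omega), ← ih (n - 1) (by omega), qHermite_succ]
      have h1 : Complex.exp (θ * Complex.I) + Complex.exp (-θ * Complex.I) = 2 * Complex.cos θ := by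
        rw [Complex.cos]; ring
      have h2 : Complex.exp (θ * Complex.I) * Complex.exp (-θ * Complex.I) = 1 := by
        rw [← Complex.exp_add]; simp
      rw [h1, h2]
      push_cast
      ring

/-- On `[-1, 1]` the polynomials `h_n / (q;q)_n` grow at most linearly in `n`. -/
lemma exists_abs_qHermite_div_le {q : ℝ} (hq : |q| < 1) :
    ∃ M : ℝ, 0 < M ∧ ∀ x ∈ Set.Icc (-1 : ℝ) 1, ∀ n : ℕ,
      |qHermite x q n / qPoch q q n| ≤ M * (n + 1) := by
  obtain ⟨M, hM, h⟩ := exists_norm_qPoch_inv_le (𝕜 := ℂ) (norm_ofReal_lt_one hq)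
  refine ⟨M * M, by positivity, fun x hx n => ?_⟩
  obtain ⟨θ, rfl⟩ : ∃ θ, Real.cos θ = x := ⟨Real.arccos x, Real.cos_arccos hx.1 hx.2⟩
  have hq' : ∀ n, qPoch (q : ℂ) q n ≠ 0 :=
    qPoch_ne_zero (norm_ofReal_lt_one hq) (norm_ofReal_lt_one hq)
  have e : |qHermite (Real.cos θ) q n / qPoch q q n| =
      ‖((qHermite (Real.cos θ) q n : ℝ) : ℂ) / qPoch (q : ℂ) q n‖ := by
    have := ofReal_qPoch (𝕜 := ℂ) q q n
    simp only [Complex.coe_algebraMap] at this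
    rw [← this, ← Complex.ofReal_div, Complex.norm_real, Real.norm_eq_abs]
  rw [e, qHermite_cos hq, S2_eq_qConv hq', qConv_div hq']
  have hexp : ‖Complex.exp (-θ * Complex.I)‖ = 1 := by
    have := Complex.norm_exp_ofReal_mul_I (-θ)
    simpa using this
  calc _ ≤ ∑ k ∈ Finset.range (n + 1), M * M := by
        refine norm_sum_le_of_le _ fun k _ => ?_
        rw [div_eq_mul_inv, div_eq_mul_inv, norm_mul, norm_mul, norm_mul, norm_pow, norm_pow,
          Complex.norm_exp_ofReal_mul_I, hexp, one_pow, one_pow, one_mul, one_mul]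
        gcongr
        exacts [h k, h _]
    _ = _ := by simp; ring

lemma continuous_qHermite (q : ℝ) (n : ℕ) : Continuous fun x => qHermite x q n := by
  induction n using Nat.strong_induction_on with
  | _ n ih =>
    rcases n with _ | n
    · simpa [qHermite] using continuous_const
    · simp only [qHermite_succ]
      have h1 := ih n (by omega)
      have h2 := ih (n - 1) (by omega)
      fun_prop

lemma qHermite_neg (x q : ℝ) (n : ℕ) : qHermite (-x) q n = (-1) ^ n * qHermite x q n := by
  induction n using Nat.strong_induction_on with
  | _ n ih =>
    match n with
    | 0 => simp [qHermite]
    | 1 => simp [qHermite]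
    | n + 2 =>
      simp only [qHermite]
      rw [ih n (by omega), ih (n + 1) (by omega)]
      ring

/-- A summable majorant, uniform on `[-1, 1]`, of the terms of `φ_h`. -/
lemma exists_summable_bound_phiH {𝕜 : Type*} [RCLike 𝕜] {t : 𝕜} (ht : ‖t‖ < 1) {q : ℝ}
    (hq : |q| < 1) : ∃ u : ℕ → ℝ, Summable u ∧ ∀ j, ∀ x ∈ Set.Icc (-1 : ℝ) 1,
      ‖t ^ j / ((qPoch q q j : ℝ) : 𝕜) * ((qHermite x q j : ℝ) : 𝕜)‖ ≤ u j := by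
  obtain ⟨M, hM, h⟩ := exists_abs_qHermite_div_le hq
  refine ⟨fun j => M * ((j : ℝ) ^ 1 * ‖t‖ ^ j + ‖t‖ ^ j), ?_, fun j x hx => ?_⟩
  · refine Summable.mul_left _ (Summable.add ?_ (summable_geometric_of_lt_one (norm_nonneg t) ht))
    exact summable_pow_mul_geometric_of_norm_lt_one 1 (by simpa using ht)
  · have e : ‖t ^ j / ((qPoch q q j : ℝ) : 𝕜) * ((qHermite x q j : ℝ) : 𝕜)‖ =
        ‖t‖ ^ j * |qHermite x q j / qPoch q q j| := by
      rw [norm_mul, norm_div, norm_pow, RCLike.norm_ofReal, RCLike.norm_ofReal, abs_div]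
      ring
    rw [e]
    calc _ ≤ ‖t‖ ^ j * (M * (j + 1)) := by gcongr; exact h x hx j
      _ = _ := by ring

lemma summable_norm_phiH {𝕜 : Type*} [RCLike 𝕜] {t : 𝕜} (ht : ‖t‖ < 1) {q : ℝ}
    (hq : |q| < 1) {x : ℝ} (hx : x ∈ Set.Icc (-1 : ℝ) 1) :
    Summable fun j : ℕ => ‖t ^ j / ((qPoch q q j : ℝ) : 𝕜) * ((qHermite x q j : ℝ) : 𝕜)‖ := by
  obtain ⟨u, hu, h⟩ := exists_summable_bound_phiH ht hq
  exact Summable.of_nonneg_of_le (fun _ => norm_nonneg _) (fun j => h j x hx) hu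

lemma continuousOn_phiH {𝕜 : Type*} [RCLike 𝕜] {t : 𝕜} (ht : ‖t‖ < 1) {q : ℝ} (hq : |q| < 1) :
    ContinuousOn (fun x => phiH x t q) (Set.Icc (-1 : ℝ) 1) := by
  obtain ⟨u, hu, h⟩ := exists_summable_bound_phiH ht hq
  refine continuousOn_tsum (fun j => Continuous.continuousOn ?_) hu h
  exact continuous_const.mul (RCLike.continuous_ofReal.comp (continuous_qHermite q j))

/-- The `q`-difference equation of the generating function. -/
lemma phiH_mul_q {𝕜 : Type*} [RCLike 𝕜] {t : 𝕜} (ht : ‖t‖ < 1) {q : ℝ} (hq : |q| < 1)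
    {x : ℝ} (hx : x ∈ Set.Icc (-1 : ℝ) 1) : phiH x (t * (q : 𝕜)) q = v x t * phiH x t q := by
  have hs (t : 𝕜) (ht : ‖t‖ < 1) := (summable_norm_phiH ht hq hx).of_norm
  have htq : ‖t * (q : 𝕜)‖ < 1 := norm_mul_lt_one ht (norm_ofReal_lt_one hq)
  have hq' (n : ℕ) : qPoch (q : 𝕜) q n ≠ 0 :=
    qPoch_ne_zero (norm_ofReal_lt_one hq) (norm_ofReal_lt_one hq) n
  -- compared coefficient by coefficient: `t ^ 2` shifts the index by two and `2 t x` by one, so the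
  -- terms of lowest order are split off first
  have e : phiH x t q - phiH x (t * (q : 𝕜)) q = 2 * t * x * phiH x t q - t ^ 2 * phiH x t q := by
    simp only [phiH]
    have hL := (hs t ht).sub (hs _ htq)
    have hA := (hs t ht).mul_left (2 * t * (x : 𝕜))
    have hB := (hs t ht).mul_left (t ^ 2)
    rw [← (hs t ht).tsum_sub (hs _ htq), ← tsum_mul_left, ← tsum_mul_left,
      hL.tsum_eq_zero_add, ((summable_nat_add_iff 1).2 hL).tsum_eq_zero_add,
      hA.tsum_eq_zero_add, add_sub_assoc, ← ((summable_nat_add_iff 1).2 hA).tsum_sub hB]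
    have h1 : 1 - (q : 𝕜) ≠ 0 := one_sub_ne_zero_of_norm_lt_one (norm_ofReal_lt_one hq)
    simp only [pow_zero, sub_self, zero_add]
    congr 1
    · simp only [qPoch_succ, qPoch_zero, qHermite]
      push_cast
      field_simp
    · refine tsum_congr fun j => ?_
      simp only [ofReal_qPoch]
      have h2 := hq' j
      have h3 := one_sub_pow_succ_ne_zero hq' j
      have h4 := one_sub_pow_succ_ne_zero hq' (j + 1)
      rw [qPoch_succ _ _ (j + 1), qPoch_succ _ _ j, ← pow_succ', ← pow_succ', qHermite]
      push_cast
      field_simp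
      ring
  rw [v]
  linear_combination -e

lemma phiH_zero_left {𝕜 : Type*} [RCLike 𝕜] (x q : ℝ) : phiH x (0 : 𝕜) q = 1 := by
  rw [phiH, tsum_eq_single 0]
  · simp [qPoch_zero, qHermite]
  · intro j hj; simp [hj]

/-- Iterating the `q`-difference equation: `φ_h(x|t) = ∏ 1 / v(x|t qᵏ)`, in multiplied-out form. -/
lemma tendsto_prod_v_mul_phiH {𝕜 : Type*} [RCLike 𝕜] {t : 𝕜} (ht : ‖t‖ < 1) {q : ℝ}
    (hq : |q| < 1) {x : ℝ} (hx : x ∈ Set.Icc (-1 : ℝ) 1) :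
    Tendsto (fun N : ℕ => (∏ k ∈ Finset.range N, v x (t * (q : 𝕜) ^ k)) * phiH x t q) atTop
      (𝓝 1) := by
  have hq' : ‖(q : 𝕜)‖ < 1 := norm_ofReal_lt_one hq
  have iter (N : ℕ) : (∏ k ∈ Finset.range N, v x (t * (q : 𝕜) ^ k)) * phiH x t q =
      phiH x (t * (q : 𝕜) ^ N) q := by
    induction N with
    | zero => simp
    | succ N ih =>
      rw [Finset.prod_range_succ, pow_succ, ← mul_assoc t,
        phiH_mul_q (norm_mul_pow_lt_one ht hq' N) hq hx, ← ih]
      ring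
  simp only [iter]
  have := tendsto_tsum_mul_pow_pow (summable_norm_phiH ht hq hx) hq'
  simp only [qPoch_zero, pow_zero, qHermite, RCLike.ofReal_one, mul_one, div_one] at this
  refine this.congr fun N => tsum_congr fun j => ?_
  rw [mul_pow]; ring

/-! ### The moments of the `q`-Hermite density -/

lemma four_mul_sq_mul_qHermite (x q : ℝ) (n : ℕ) :
    4 * x ^ 2 * qHermite x q (n + 2) = qHermite x q (n + 4) +
      (2 - q ^ (n + 2) - q ^ (n + 3)) * qHermite x q (n + 2) +
      (1 - q ^ (n + 2)) * (1 - q ^ (n + 1)) * qHermite x q n := by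
  have h1 : qHermite x q (n + 2) =
    2 * x * qHermite x q (n + 1) - (1 - q ^ (n + 1)) * qHermite x q n := qHermite_succ x q (n + 1)
  have h2 : qHermite x q (n + 3) =
    2 * x * qHermite x q (n + 2) - (1 - q ^ (n + 2)) * qHermite x q (n + 1) :=
    qHermite_succ x q (n + 2)
  have h3 : qHermite x q (n + 4) =
    2 * x * qHermite x q (n + 3) - (1 - q ^ (n + 3)) * qHermite x q (n + 2) :=
    qHermite_succ x q (n + 3)
  linear_combination -h3 - 2 * x * h2 - (1 - q ^ (n + 2)) * h1

/-- The integral of `hₙ(cos θ)` over `[0, π]` against the truncated weight `∏_{k<N} l(cos θ|qᵏ)`. -/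
def truncMoment (q : ℝ) (N n : ℕ) : ℝ :=
  ∫ θ in (0 : ℝ)..Real.pi, qHermite (Real.cos θ) q n * ∏ k ∈ Finset.range N, l (Real.cos θ) (q ^ k)

lemma continuous_l (a : ℝ) : Continuous fun x => l x a := by unfold l; fun_prop

lemma intervalIntegrable_truncMoment (q : ℝ) (N n : ℕ) : IntervalIntegrable
    (fun θ => qHermite (Real.cos θ) q n * ∏ k ∈ Finset.range N, l (Real.cos θ) (q ^ k))
    volume 0 Real.pi := by
  refine Continuous.intervalIntegrable ?_ _ _
  refine ((continuous_qHermite q n).comp Real.continuous_cos).mul ?_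
  exact continuous_finsetProd _ fun k _ => (continuous_l _).comp Real.continuous_cos

lemma truncMoment_succ_zero (q : ℝ) (N : ℕ) :
    truncMoment q (N + 1) 0 = (1 + q ^ N) ^ 2 * truncMoment q N 0 -
      q ^ N * (truncMoment q N 2 + (1 - q) * truncMoment q N 0) := by
  have I (n : ℕ) := intervalIntegrable_truncMoment q N n
  simp only [truncMoment]
  rw [← intervalIntegral.integral_const_mul, ← intervalIntegral.integral_const_mul,
    ← intervalIntegral.integral_add (I 2) ((I 0).const_mul _),
    ← intervalIntegral.integral_const_mul, ← intervalIntegral.integral_sub ((I 0).const_mul _)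
      (((I 2).add ((I 0).const_mul _)).const_mul _)]
  refine intervalIntegral.integral_congr fun θ _ => ?_
  simp only [Finset.prod_range_succ, qHermite]
  rw [show l (Real.cos θ) (q ^ N) = (1 + q ^ N) ^ 2 - 4 * q ^ N * Real.cos θ ^ 2 from rfl]
  ring

lemma truncMoment_succ (q : ℝ) (N n : ℕ) :
    truncMoment q (N + 1) (n + 2) = (1 + q ^ N) ^ 2 * truncMoment q N (n + 2) -
      q ^ N * (truncMoment q N (n + 4) +
        (2 - q ^ (n + 2) - q ^ (n + 3)) * truncMoment q N (n + 2) +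
        (1 - q ^ (n + 2)) * (1 - q ^ (n + 1)) * truncMoment q N n) := by
  have I (n : ℕ) := intervalIntegrable_truncMoment q N n
  simp only [truncMoment]
  rw [← intervalIntegral.integral_const_mul, ← intervalIntegral.integral_const_mul,
    ← intervalIntegral.integral_const_mul,
    ← intervalIntegral.integral_add (I (n + 4)) ((I (n + 2)).const_mul _),
    ← intervalIntegral.integral_add ((I (n + 4)).add ((I (n + 2)).const_mul _))
      ((I n).const_mul _),
    ← intervalIntegral.integral_const_mul, ← intervalIntegral.integral_sub
      ((I (n + 2)).const_mul _)
      ((((I (n + 4)).add ((I (n + 2)).const_mul _)).add ((I n).const_mul _)).const_mul _)]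
  refine intervalIntegral.integral_congr fun θ _ => ?_
  have h := four_mul_sq_mul_qHermite (Real.cos θ) q n
  simp only [Finset.prod_range_succ]
  rw [show l (Real.cos θ) (q ^ N) = (1 + q ^ N) ^ 2 - 4 * q ^ N * Real.cos θ ^ 2 from rfl]
  linear_combination -q ^ N * (∏ k ∈ Finset.range N, l (Real.cos θ) (q ^ k)) * h

/-- Without weight, only the constant Fourier coefficient of `h_{2m}(cos θ)` survives. -/
lemma truncMoment_zero_left {q : ℝ} (hq : |q| < 1) (m : ℕ) :
    truncMoment q 0 (2 * m) = Real.pi * (qPoch q q (2 * m) / (qPoch q q m * qPoch q q m)) := by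
  have hq' : ∀ n, qPoch (q : ℂ) q n ≠ 0 :=
    qPoch_ne_zero (norm_ofReal_lt_one hq) (norm_ofReal_lt_one hq)
  -- the factor `if k ≤ 2 m` keeps the truncated subtraction `2 m - k` out of the way
  have hint (k : ℕ) : ∫ θ in (0 : ℝ)..Real.pi, Complex.exp (θ * Complex.I) ^ k *
      Complex.exp (-θ * Complex.I) ^ (2 * m - k) * (if k ≤ 2 * m then 1 else 0) =
      if k = m then (Real.pi : ℂ) else 0 := by
    split_ifs with h1 h2 h2
    · subst h2
      have (θ : ℝ) : Complex.exp (θ * Complex.I) ^ k *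
          Complex.exp (-θ * Complex.I) ^ (2 * k - k) * 1 = 1 := by
        rw [show 2 * k - k = k by omega, ← mul_pow, ← Complex.exp_add]
        simp
      simp only [this]
      simp
    · have hne : 2 * ((k : ℂ) - m) * Complex.I ≠ 0 := by
        have : (k : ℂ) - m ≠ 0 := sub_ne_zero.2 (by exact_mod_cast h2)
        simp [this]
      have (θ : ℝ) : Complex.exp (θ * Complex.I) ^ k *
          Complex.exp (-θ * Complex.I) ^ (2 * m - k) * 1 =
          Complex.exp (2 * ((k : ℂ) - m) * Complex.I * θ) := by
        rw [mul_one, ← Complex.exp_nat_mul, ← Complex.exp_nat_mul, ← Complex.exp_add,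
          Nat.cast_sub h1]
        congr 1
        push_cast
        ring
      simp only [this]
      rw [integral_exp_mul_complex hne]
      have : Complex.exp (2 * ((k : ℂ) - m) * Complex.I * (Real.pi : ℝ)) = 1 := by
        rw [Complex.exp_eq_one_iff]
        exact ⟨(k : ℤ) - m, by push_cast; ring⟩
      rw [this]
      simp
    · omega
    · simp
  have key : ((truncMoment q 0 (2 * m) : ℝ) : ℂ) =
      (Real.pi : ℂ) * qBinom (q : ℂ) (2 * m) m := by
    rw [truncMoment, ← intervalIntegral.integral_ofReal]
    have e (θ : ℝ) : ((qHermite (Real.cos θ) q (2 * m) *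
        ∏ k ∈ Finset.range 0, l (Real.cos θ) (q ^ k) : ℝ) : ℂ) =
        ∑ k ∈ Finset.range (2 * m + 1), qBinom (q : ℂ) (2 * m) k *
          (Complex.exp (θ * Complex.I) ^ k * Complex.exp (-θ * Complex.I) ^ (2 * m - k) *
            (if k ≤ 2 * m then 1 else 0)) := by
      rw [Finset.prod_range_zero, mul_one, qHermite_cos hq, S2_eq_qConv hq', qConv]
      refine Finset.sum_congr rfl fun k hk => ?_
      rw [if_pos (Nat.lt_succ_iff.1 (Finset.mem_range.1 hk))]
      ring
    simp only [e]
    rw [intervalIntegral.integral_finsetSum]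
    · simp only [intervalIntegral.integral_const_mul, hint]
      simp only [mul_ite, mul_zero, Finset.sum_ite_eq', Finset.mem_range]
      rw [if_pos (by omega), mul_comm]
    · intro k _
      exact Continuous.intervalIntegrable (by fun_prop) _ _
  rw [qBinom_eq hq' (by omega), show 2 * m - m = m by omega] at key
  have hc := ofReal_qPoch (𝕜 := ℂ) q q
  simp only [Complex.coe_algebraMap] at hc
  rw [← hc, ← hc] at key
  exact_mod_cast key

/-- Closed form of the moments of the truncated weight, by induction on the truncation: with
`β = q ^ N`, the weight is the one of the Rogers polynomials of parameter `β`. -/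
lemma truncMoment_eq {q : ℝ} (hq : |q| < 1) (N : ℕ) :
    (∀ m, truncMoment q N (2 * m) = truncMoment q N 0 *
      ((q ^ N) ^ m * qPoch q q (2 * m) / (qPoch q q m * qPoch (q * q ^ N) q m))) ∧
    truncMoment q (N + 1) 0 = truncMoment q N 0 *
      ((1 + q ^ N) * (1 - q * (q ^ N) ^ 2) / (1 - q * q ^ N)) := by
  have hq1 : ‖q‖ < 1 := hq
  have hq' := qPoch_ne_zero hq1 hq1
  -- the total mass at `N + 1` involves only the moments of order `0` and `2` at `N`
  have second (N : ℕ) (h : ∀ m, truncMoment q N (2 * m) = truncMoment q N 0 *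
      ((q ^ N) ^ m * qPoch q q (2 * m) / (qPoch q q m * qPoch (q * q ^ N) q m))) :
      truncMoment q (N + 1) 0 = truncMoment q N 0 *
      ((1 + q ^ N) * (1 - q * (q ^ N) ^ 2) / (1 - q * q ^ N)) := by
    have h2 := h 1
    rw [truncMoment_succ_zero, h2]
    have h3 : 1 - q * q ^ N ≠ 0 := one_sub_mul_pow_ne_zero hq1 hq1 N
    have h4 : 1 - q ≠ 0 := one_sub_ne_zero_of_norm_lt_one hq1
    simp only [mul_one, qPoch_succ, qPoch_zero, pow_zero, pow_one, one_mul]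
    generalize hD : 1 - q * q ^ N = D at *
    field_simp
    rw [← hD]
    ring
  induction N with
  | zero =>
    have h0 : truncMoment q 0 0 = Real.pi := by
      have := truncMoment_zero_left hq 0
      simpa [qPoch_zero] using this
    have h1 (m : ℕ) : truncMoment q 0 (2 * m) = truncMoment q 0 0 *
        ((q ^ 0) ^ m * qPoch q q (2 * m) / (qPoch q q m * qPoch (q * q ^ 0) q m)) := by
      rw [h0, truncMoment_zero_left hq]
      simp
    exact ⟨h1, second 0 h1⟩
  | succ N ih =>
    obtain ⟨ih1, ih2⟩ := ih
    have h1 (m : ℕ) : truncMoment q (N + 1) (2 * m) = truncMoment q (N + 1) 0 *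
        ((q ^ (N + 1)) ^ m * qPoch q q (2 * m) / (qPoch q q m * qPoch (q * q ^ (N + 1)) q m)) := by
      rcases m with _ | m
      · simp [qPoch_zero]
      have n1 : ‖q * q ^ N‖ < 1 := norm_mul_pow_lt_one hq1 hq1 N
      have hb : 1 - q * q ^ N ≠ 0 := one_sub_ne_zero_of_norm_lt_one n1
      have hb1 := one_sub_mul_pow_ne_zero n1 hq1 m
      have hb2 := one_sub_mul_pow_ne_zero n1 hq1 (m + 1)
      have hy1 := one_sub_mul_pow_ne_zero hq1 hq1 m
      have hy2 := one_sub_mul_pow_ne_zero hq1 hq1 (m + 1)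
      have hB := hq' m
      have hW := qPoch_ne_zero n1 hq1 m
      have hs : (1 - q * q ^ N) * qPoch (q * q ^ (N + 1)) q (m + 1) =
          qPoch (q * q ^ N) q m * (1 - q * q ^ N * q ^ m) * (1 - q * q ^ N * q ^ (m + 1)) := by
        rw [← qPoch_succ, ← qPoch_succ, qPoch_succ' (q * q ^ N), pow_succ, mul_assoc q]
      have hs' : qPoch (q * q ^ (N + 1)) q (m + 1) = qPoch (q * q ^ N) q m *
          (1 - q * q ^ N * q ^ m) * (1 - q * q ^ N * q ^ (m + 1)) / (1 - q * q ^ N) := by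
        rw [← hs]; field_simp
      have hrec := truncMoment_succ q N (2 * m)
      rw [show 2 * m + 2 = 2 * (m + 1) by ring, show 2 * m + 4 = 2 * (m + 2) by ring, ih1 (m + 1),
        ih1 (m + 2), ih1 m] at hrec
      rw [hrec, ih2, hs', show 2 * (m + 2) = 2 * m + 1 + 1 + 1 + 1 by ring,
        show 2 * (m + 1) = 2 * m + 1 + 1 by ring]
      simp only [qPoch_succ]
      generalize truncMoment q N 0 = K
      generalize qPoch q q (2 * m) = A
      generalize qPoch q q m = B at *
      generalize qPoch (q * q ^ N) q m = W at *
      generalize hD0 : 1 - q * q ^ N = D0 at *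
      generalize hD1 : 1 - q * q ^ N * q ^ m = D1 at *
      generalize hD2 : 1 - q * q ^ N * q ^ (m + 1) = D2 at *
      generalize hE1 : 1 - q * q ^ m = E1 at *
      generalize hE2 : 1 - q * q ^ (m + 1) = E2 at *
      clear hs hs' hrec ih1 ih2 second
      rw [pow_succ q N, mul_pow]
      generalize q ^ N = β at *
      field_simp
      rw [← hD1, ← hD2, ← hE1, ← hE2]
      ring
    exact ⟨h1, second (N + 1) h1⟩

lemma truncMoment_succ_zero_eq {q : ℝ} (hq : |q| < 1) (N : ℕ) :
    truncMoment q (N + 1) 0 =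
      2 * Real.pi * (qPoch q q (2 * N + 1) / (qPoch q q N * qPoch q q (N + 1))) := by
  have hq1 : ‖q‖ < 1 := hq
  have h4 : 1 - q ≠ 0 := one_sub_ne_zero_of_norm_lt_one hq1
  induction N with
  | zero =>
    rw [(truncMoment_eq hq 0).2]
    have := truncMoment_zero_left hq 0
    simp only [mul_zero, qPoch_zero, mul_one, div_one] at this
    rw [this]
    simp [qPoch_succ, qPoch_zero, h4]
    ring
  | succ N ih =>
    rw [(truncMoment_eq hq (N + 1)).2, ih, show 2 * (N + 1) + 1 = 2 * N + 1 + 1 + 1 by ring]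
    simp only [qPoch_succ _ _ (2 * N + 1 + 1), qPoch_succ _ _ (2 * N + 1), qPoch_succ _ _ (N + 1),
      qPoch_succ _ _ N]
    have h1 := qPoch_ne_zero hq1 hq1 N
    have h2 := one_sub_mul_pow_ne_zero hq1 hq1 N
    have h3 := one_sub_mul_pow_ne_zero hq1 hq1 (N + 1)
    generalize hD : 1 - q * q ^ N = D at *
    generalize hE : 1 - q * q ^ (N + 1) = E at *
    field_simp
    rw [← hD]
    ring

/-- Letting the truncation tend to infinity kills all even moments but the first. -/
lemma tendsto_truncMoment {q : ℝ} (hq : |q| < 1) (m : ℕ) :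
    Tendsto (fun N => truncMoment q N (2 * m)) atTop
      (𝓝 (if m = 0 then 2 * Real.pi / qPochInf q q else 0)) := by
  have hq1 : ‖q‖ < 1 := hq
  have hinf := qPochInf_ne_zero hq1 hq1
  have hT := tendsto_qPoch q hq1
  have h0 : Tendsto (fun N => truncMoment q N 0) atTop (𝓝 (2 * Real.pi / qPochInf q q)) := by
    rw [← tendsto_add_atTop_iff_nat 1]
    simp only [truncMoment_succ_zero_eq hq]
    have hodd : Tendsto (fun N : ℕ => 2 * N + 1) atTop atTop :=
      tendsto_atTop_mono (fun N => show N ≤ 2 * N + 1 by omega) tendsto_id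
    have := ((hT.comp hodd).div (hT.mul ((tendsto_add_atTop_iff_nat 1).2 hT))
      (mul_ne_zero hinf hinf)).const_mul (2 * Real.pi)
    rw [show 2 * Real.pi / qPochInf q q =
      2 * Real.pi * (qPochInf q q / (qPochInf q q * qPochInf q q)) by field_simp]
    exact this
  by_cases hm : m = 0
  · subst hm; simpa using h0
  · have hpow : Tendsto (fun N : ℕ => q ^ N) atTop (𝓝 0) :=
      tendsto_pow_atTop_nhds_zero_of_norm_lt_one hq1
    have hden : Tendsto (fun N : ℕ => qPoch q q m * qPoch (q * q ^ N) q m) atTop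
        (𝓝 (qPoch q q m * 1)) := by
      refine Tendsto.const_mul _ ?_
      have : Tendsto (fun N : ℕ => ∏ j ∈ Finset.range m, (1 - q * q ^ N * q ^ j)) atTop
          (𝓝 (∏ j ∈ Finset.range m, (1 - q * 0 * q ^ j))) :=
        tendsto_finsetProd _ fun j _ => tendsto_const_nhds.sub ((hpow.const_mul q).mul_const _)
      simpa [qPoch] using this
    have hnum : Tendsto (fun N : ℕ => (q ^ N) ^ m * qPoch q q (2 * m)) atTop
        (𝓝 (0 * qPoch q q (2 * m))) := by
      refine Tendsto.mul_const _ ?_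
      simpa [hm] using hpow.pow m
    have := h0.mul (hnum.div hden (by simpa using qPoch_ne_zero hq1 hq1 m))
    simp only [zero_mul, zero_div, mul_zero] at this
    rw [if_neg hm]
    exact this.congr fun N => ((truncMoment_eq hq N).1 m).symm

/-- The summable majorant of `l(x|qᵏ) - 1` on `[-1, 1]`. -/
lemma abs_l_sub_one_le {q : ℝ} (hq : |q| < 1) (k : ℕ) {x : ℝ} (hx : x ∈ Set.Icc (-1 : ℝ) 1) :
    ‖l x (q ^ k) - 1‖ ≤ 7 * |q| ^ k := by
  have h1 : |q ^ k| = |q| ^ k := abs_pow q k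
  have h2 : |q| ^ k ≤ 1 := pow_le_one₀ (abs_nonneg q) hq.le
  have h3 : x ^ 2 ≤ 1 := by have := hx.1; have := hx.2; nlinarith
  have e : l x (q ^ k) - 1 = q ^ k * (2 + q ^ k - 4 * x ^ 2) := by rw [l]; ring
  rw [e, norm_mul, Real.norm_eq_abs, h1, mul_comm]
  refine mul_le_mul_of_nonneg_right ?_ (by positivity)
  rw [Real.norm_eq_abs, abs_le]
  rw [← h1, abs_le] at h2
  constructor <;> nlinarith [sq_nonneg x]

lemma summable_seven_mul_pow {q : ℝ} (hq : |q| < 1) : Summable fun k : ℕ => 7 * |q| ^ k :=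
  (summable_geometric_of_lt_one (abs_nonneg q) hq).mul_left 7

lemma multipliable_l {q : ℝ} (hq : |q| < 1) {x : ℝ} (hx : x ∈ Set.Icc (-1 : ℝ) 1) :
    Multipliable fun k : ℕ => l x (q ^ k) := by
  have := multipliable_one_add_of_summable (f := fun k : ℕ => l x (q ^ k) - 1)
    (Summable.of_nonneg_of_le (fun _ => norm_nonneg _) (fun k => abs_l_sub_one_le hq k hx)
      (summable_seven_mul_pow hq))
  simpa using this

lemma tprod_l_eq {q : ℝ} (hq : |q| < 1) {x : ℝ} (hx : x ∈ Set.Icc (-1 : ℝ) 1) :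
    ∏' k : ℕ, l x (q ^ k) = 4 * (1 - x ^ 2) * ∏' k : ℕ, l x (q ^ (k + 1)) := by
  have h := multipliable_one_add_of_summable (f := fun k : ℕ => l x (q ^ (k + 1)) - 1)
    (Summable.of_nonneg_of_le (fun _ => norm_nonneg _) (fun k => abs_l_sub_one_le hq (k + 1) hx)
      ((summable_nat_add_iff (f := fun k : ℕ => 7 * |q| ^ k) 1).2 (summable_seven_mul_pow hq)))
  simp only [add_sub_cancel] at h
  rw [tprod_eq_zero_mul' (f := fun k : ℕ => l x (q ^ k)) h]
  congr 1
  rw [pow_zero, l]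
  ring

lemma continuousOn_tprod_l {q : ℝ} (hq : |q| < 1) :
    ContinuousOn (fun x => ∏' k : ℕ, l x (q ^ (k + 1))) (Set.Icc (-1 : ℝ) 1) := by
  have h := Summable.hasProdUniformlyOn_nat_one_add (f := fun (k : ℕ) x => l x (q ^ (k + 1)) - 1)
    (isCompact_Icc (a := (-1 : ℝ)) (b := 1))
    ((summable_nat_add_iff (f := fun k : ℕ => 7 * |q| ^ k) 1).2 (summable_seven_mul_pow hq))
    (Eventually.of_forall fun k x hx => abs_l_sub_one_le hq (k + 1) hx)
    (fun k => ((continuous_l _).sub continuous_const).continuousOn)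
  simp only [add_sub_cancel] at h
  refine (hasProdUniformlyOn_iff_tendstoUniformlyOn.1 h).continuousOn
    (Frequently.of_forall fun s => ?_)
  exact continuousOn_finsetProd _ fun k _ => (continuous_l _).continuousOn

lemma continuousOn_fH {q : ℝ} (hq : |q| < 1) :
    ContinuousOn (fun x => fH x q) (Set.Icc (-1 : ℝ) 1) := by
  unfold fH
  refine ContinuousOn.mul ?_ (continuousOn_tprod_l hq)
  exact Continuous.continuousOn (by fun_prop)

lemma fH_neg (x q : ℝ) : fH (-x) q = fH x q := by simp [fH, l]

lemma fH_cos_mul_sin {q : ℝ} (hq : |q| < 1) {θ : ℝ} (hθ : θ ∈ Set.Icc 0 Real.pi) :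
    fH (Real.cos θ) q * Real.sin θ =
      qPochInf q q / (2 * Real.pi) * ∏' k : ℕ, l (Real.cos θ) (q ^ k) := by
  rw [tprod_l_eq hq ⟨Real.neg_one_le_cos θ, Real.cos_le_one θ⟩, fH, ← Real.sin_sq,
    Real.sqrt_sq (Real.sin_nonneg_of_mem_Icc hθ)]
  have := Real.pi_ne_zero
  field_simp
  ring

lemma tendsto_truncMoment_integral {q : ℝ} (hq : |q| < 1) (n : ℕ) :
    Tendsto (fun N => truncMoment q N n) atTop
      (𝓝 (∫ θ in (0 : ℝ)..Real.pi,
        qHermite (Real.cos θ) q n * ∏' k : ℕ, l (Real.cos θ) (q ^ k))) := by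
  have hx (θ : ℝ) : Real.cos θ ∈ Set.Icc (-1 : ℝ) 1 := ⟨Real.neg_one_le_cos θ, Real.cos_le_one θ⟩
  have hcont : Continuous fun θ => |qHermite (Real.cos θ) q n| :=
    ((continuous_qHermite q n).comp Real.continuous_cos).abs
  refine intervalIntegral.tendsto_integral_filter_of_dominated_convergence
    (fun θ => |qHermite (Real.cos θ) q n| * Real.exp (∑' k : ℕ, 7 * |q| ^ k)) ?_ ?_ ?_ ?_
  · exact Eventually.of_forall fun N =>
      (intervalIntegrable_truncMoment q N n).aestronglyMeasurable_restrict_uIoc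
  · refine Eventually.of_forall fun N => Eventually.of_forall fun θ _ => ?_
    rw [norm_mul, Real.norm_eq_abs]
    refine mul_le_mul_of_nonneg_left ?_ (abs_nonneg _)
    have h1 := Finset.norm_prod_one_add_sub_one_le (Finset.range N)
      (fun k => l (Real.cos θ) (q ^ k) - 1)
    simp only [add_sub_cancel] at h1
    have h2 : ∑ k ∈ Finset.range N, ‖l (Real.cos θ) (q ^ k) - 1‖ ≤ ∑' k : ℕ, 7 * |q| ^ k :=
      (Finset.sum_le_sum fun k _ => abs_l_sub_one_le hq k (hx θ)).trans
        ((summable_seven_mul_pow hq).sum_le_tsum _ fun k _ => by positivity)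
    have h3 := norm_le_norm_sub_add (∏ k ∈ Finset.range N, l (Real.cos θ) (q ^ k)) 1
    have h4 := Real.exp_le_exp.2 h2
    rw [norm_one] at h3
    linarith
  · exact (hcont.mul continuous_const).intervalIntegrable _ _
  · exact Eventually.of_forall fun θ _ =>
      (multipliable_l hq (hx θ)).tendsto_prod_tprod_nat.const_mul _

/-- The continuous `q`-Hermite polynomials of positive degree have mean zero. -/
theorem integral_qHermite_mul_fH {q : ℝ} (hq : |q| < 1) (n : ℕ) :
    ∫ x in (-1 : ℝ)..1, qHermite x q n * fH x q = if n = 0 then 1 else 0 := by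
  have hq1 : ‖q‖ < 1 := hq
  rcases Nat.even_or_odd' n with ⟨m, rfl | rfl⟩
  · have hsub : ∫ θ in (0 : ℝ)..Real.pi,
        ((fun x => qHermite x q (2 * m) * fH x q) ∘ Real.cos) θ * (-Real.sin θ) =
        ∫ x in Real.cos 0..Real.cos Real.pi, qHermite x q (2 * m) * fH x q := by
      refine intervalIntegral.integral_comp_mul_deriv' (fun θ _ => Real.hasDerivAt_cos θ)
        (Real.continuous_sin.neg.continuousOn) (ContinuousOn.mono
          ((continuous_qHermite q _).continuousOn.mul (continuousOn_fH hq)) ?_)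
      rintro _ ⟨θ, -, rfl⟩
      exact ⟨Real.neg_one_le_cos θ, Real.cos_le_one θ⟩
    rw [Real.cos_zero, Real.cos_pi] at hsub
    rw [intervalIntegral.integral_symm, ← hsub, ← intervalIntegral.integral_neg]
    have e : ∫ θ in (0 : ℝ)..Real.pi,
        -(((fun x => qHermite x q (2 * m) * fH x q) ∘ Real.cos) θ * (-Real.sin θ)) =
        ∫ θ in (0 : ℝ)..Real.pi, qPochInf q q / (2 * Real.pi) *
          (qHermite (Real.cos θ) q (2 * m) * ∏' k : ℕ, l (Real.cos θ) (q ^ k)) := by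
      refine intervalIntegral.integral_congr fun θ hθ => ?_
      rw [Set.uIcc_of_le Real.pi_pos.le] at hθ
      have := fH_cos_mul_sin hq hθ
      simp only [Function.comp]
      linear_combination qHermite (Real.cos θ) q (2 * m) * this
    rw [e, intervalIntegral.integral_const_mul, tendsto_nhds_unique
      (tendsto_truncMoment_integral hq (2 * m)) (tendsto_truncMoment hq m)]
    have h1 := qPochInf_ne_zero hq1 hq1
    have h2 := Real.pi_ne_zero
    by_cases hm : m = 0
    · simp only [hm, if_true, mul_zero]
      field_simp
    · simp [hm]
  · have h := intervalIntegral.integral_comp_neg (a := -1) (b := 1)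
      (fun x => qHermite x q (2 * m + 1) * fH x q)
    have e (x : ℝ) : qHermite (-x) q (2 * m + 1) * fH (-x) q =
        -(qHermite x q (2 * m + 1) * fH x q) := by
      rw [qHermite_neg, fH_neg, pow_succ, pow_mul]
      ring
    simp only [e, intervalIntegral.integral_neg, neg_neg] at h
    simp only [Nat.add_eq_zero_iff, one_ne_zero, and_false, if_false]
    linarith

/-! ### Moments of a weight multiplied by `φ_h` -/

/-- The integral of `hₙ` over `[-1, 1]` against a weight `g`. -/
def moment {𝕜 : Type*} [RCLike 𝕜] (q : ℝ) (g : ℝ → 𝕜) (n : ℕ) : 𝕜 :=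
  ∫ x in (-1 : ℝ)..1, ((qHermite x q n : ℝ) : 𝕜) * g x

lemma continuousOn_qHermite_mul {𝕜 : Type*} [RCLike 𝕜] {g : ℝ → 𝕜}
    (hg : ContinuousOn g (Set.Icc (-1) 1)) (q : ℝ) (n : ℕ) :
    ContinuousOn (fun x => ((qHermite x q n : ℝ) : 𝕜) * g x) (Set.Icc (-1) 1) :=
  (RCLike.continuous_ofReal.comp (continuous_qHermite q n)).continuousOn.mul hg

lemma intervalIntegrable_of_continuousOn_Icc {𝕜 : Type*} [RCLike 𝕜] {g : ℝ → 𝕜}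
    (hg : ContinuousOn g (Set.Icc (-1) 1)) : IntervalIntegrable g volume (-1) 1 :=
  ContinuousOn.intervalIntegrable_of_Icc (by norm_num) hg

lemma continuousOn_phiH_mul {𝕜 : Type*} [RCLike 𝕜] {g : ℝ → 𝕜}
    (hg : ContinuousOn g (Set.Icc (-1) 1)) {a : 𝕜} (ha : ‖a‖ < 1) {q : ℝ} (hq : |q| < 1) :
    ContinuousOn (fun x => phiH x a q * g x) (Set.Icc (-1) 1) :=
  (continuousOn_phiH ha hq).mul hg

/-- The total mass of `φ_a g`, obtained by integrating the series of `φ_a` term by term. -/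
lemma moment_phiH_mul_zero {𝕜 : Type*} [RCLike 𝕜] {g : ℝ → 𝕜}
    (hg : ContinuousOn g (Set.Icc (-1) 1)) {a : 𝕜} (ha : ‖a‖ < 1) {q : ℝ} (hq : |q| < 1) :
    moment q (fun x => phiH x a q * g x) 0 = ∑' j, a ^ j / qPoch (q : 𝕜) q j * moment q g j := by
  obtain ⟨u, hu, hbound⟩ := exists_summable_bound_phiH ha hq
  obtain ⟨M, hM⟩ := isCompact_Icc.exists_bound_of_continuousOn hg
  have hIoc : Set.uIoc (-1 : ℝ) 1 ⊆ Set.Icc (-1) 1 := by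
    rw [Set.uIoc_of_le (by norm_num)]
    exact Set.Ioc_subset_Icc_self
  have key : HasSum (fun j => ∫ x in (-1 : ℝ)..1,
      a ^ j / ((qPoch q q j : ℝ) : 𝕜) * ((qHermite x q j : ℝ) : 𝕜) * g x)
      (∫ x in (-1 : ℝ)..1, phiH x a q * g x) := by
    refine intervalIntegral.hasSum_integral_of_dominated_convergence (fun j _ => u j * M)
      (fun j => ?_) (fun j => ?_) ?_ intervalIntegrable_const ?_
    · have h := (intervalIntegrable_of_continuousOn_Icc
        (continuousOn_qHermite_mul hg q j)).aestronglyMeasurable_restrict_uIoc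
      simp only [mul_assoc]
      exact h.const_mul _
    · refine Eventually.of_forall fun x hx => ?_
      rw [norm_mul]
      exact mul_le_mul (hbound j x (hIoc hx)) (hM x (hIoc hx)) (norm_nonneg _)
        ((norm_nonneg _).trans (hbound j x (hIoc hx)))
    · exact Eventually.of_forall fun x _ => hu.mul_right M
    · exact Eventually.of_forall fun x hx =>
        ((summable_norm_phiH ha hq (hIoc hx)).of_norm.hasSum).mul_right (g x)
  simp only [moment, qHermite, RCLike.ofReal_one, one_mul]
  rw [← key.tsum_eq]
  refine tsum_congr fun j => ?_
  rw [← ofReal_qPoch, ← intervalIntegral.integral_const_mul]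
  simp only [mul_assoc]

/-- The contiguous relation in the parameter `a` of the moments of `φ_a g`. -/
lemma moment_phiH_mul_q {𝕜 : Type*} [RCLike 𝕜] {g : ℝ → 𝕜}
    (hg : ContinuousOn g (Set.Icc (-1) 1)) {a : 𝕜} (ha : ‖a‖ < 1) {q : ℝ} (hq : |q| < 1) (n : ℕ) :
    moment q (fun x => phiH x (a * (q : 𝕜)) q * g x) n =
      (1 + a ^ 2) * moment q (fun x => phiH x a q * g x) n
        - a * moment q (fun x => phiH x a q * g x) (n + 1)
        - a * (1 - (q : 𝕜) ^ n) * moment q (fun x => phiH x a q * g x) (n - 1) := by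
  have I (n : ℕ) := intervalIntegrable_of_continuousOn_Icc
    (continuousOn_qHermite_mul (continuousOn_phiH_mul hg ha hq) q n)
  simp only [moment]
  rw [← intervalIntegral.integral_const_mul, ← intervalIntegral.integral_const_mul,
    ← intervalIntegral.integral_const_mul,
    ← intervalIntegral.integral_sub ((I n).const_mul _) ((I (n + 1)).const_mul _),
    ← intervalIntegral.integral_sub (((I n).const_mul _).sub ((I (n + 1)).const_mul _))
      ((I (n - 1)).const_mul _)]
  refine intervalIntegral.integral_congr fun x hx => ?_
  rw [Set.uIcc_of_le (by norm_num)] at hx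
  rw [phiH_mul_q ha hq hx, qHermite_succ, v]
  push_cast
  ring

/-- The moments of `φ_a g` are determined by the contiguous relation, by the total masses, and by
their values at `a = 0`. -/
lemma moment_phiH_mul_eq {𝕜 : Type*} [RCLike 𝕜] {g : ℝ → 𝕜}
    (hg : ContinuousOn g (Set.Icc (-1) 1)) {q : ℝ} (hq : |q| < 1) (s : 𝕜 → ℕ → 𝕜)
    (h0 : ∀ a, ‖a‖ < 1 → ∑' j, a ^ j / qPoch (q : 𝕜) q j * moment q g j = s a 0)
    (hzero : ∀ n, moment q g n = s 0 n)
    (hrec : ∀ a, ‖a‖ < 1 → ∀ n, s (a * q) n =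
      (1 + a ^ 2) * s a n - a * s a (n + 1) - a * (1 - (q : 𝕜) ^ n) * s a (n - 1))
    (n : ℕ) (a : 𝕜) (ha : ‖a‖ < 1) : moment q (fun x => phiH x a q * g x) n = s a n := by
  induction n using Nat.strong_induction_on generalizing a with
  | _ n ih =>
    rcases n with _ | n
    · rw [moment_phiH_mul_zero hg ha hq, h0 a ha]
    · by_cases ha0 : a = 0
      · subst ha0
        simp only [phiH_zero_left, one_mul]
        exact hzero _
      · have h1 := moment_phiH_mul_q hg ha hq n
        have h2 := hrec a ha n
        rw [ih n (by omega) a ha, ih (n - 1) (by omega) a ha,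
          ih n (by omega) _ (norm_mul_lt_one ha (norm_ofReal_lt_one hq))] at h1
        refine mul_left_cancel₀ ha0 ?_
        linear_combination h1 - h2

/-! ### Introducing the four parameters -/

/-- The Askey–Wilson constant `(abcd)_∞ / (ab, ac, ad, bc, bd, cd)_∞`. -/
def awConst {𝕜 : Type*} [RCLike 𝕜] (a b c d q : 𝕜) : 𝕜 :=
  qPochInf (a * b * c * d) q / pairProd a b c d q

lemma awConst_comm {𝕜 : Type*} [RCLike 𝕜] (a b c d q : 𝕜) :
    awConst a b c d q = awConst c d a b q := by
  simp only [awConst, pairProd]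
  rw [mul_comm c a, mul_comm c b, mul_comm d a, mul_comm d b,
    show a * b * c * d = c * d * a * b by ring]
  ring

lemma pairProd_ne_zero {𝕜 : Type*} [RCLike 𝕜] {a b c d q : 𝕜} (hq : ‖q‖ < 1) (ha : ‖a‖ < 1)
    (hb : ‖b‖ < 1) (hc : ‖c‖ < 1) (hd : ‖d‖ < 1) : pairProd a b c d q ≠ 0 := by
  have h {u w : 𝕜} (hu : ‖u‖ < 1) (hw : ‖w‖ < 1) : qPochInf (u * w) q ≠ 0 :=
    qPochInf_ne_zero (norm_mul_lt_one hu hw) hq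
  simp [pairProd, h ha hb, h ha hc, h ha hd, h hb hc, h hb hd, h hc hd]

lemma awConst_ne_zero {𝕜 : Type*} [RCLike 𝕜] {a b c d q : 𝕜} (hq : ‖q‖ < 1) (ha : ‖a‖ < 1)
    (hb : ‖b‖ < 1) (hc : ‖c‖ < 1) (hd : ‖d‖ < 1) : awConst a b c d q ≠ 0 :=
  div_ne_zero (qPochInf_ne_zero
    (norm_mul_lt_one (norm_mul_lt_one (norm_mul_lt_one ha hb) hc) hd) hq)
    (pairProd_ne_zero hq ha hb hc hd)

lemma awConst_mul_q {𝕜 : Type*} [RCLike 𝕜] {a b c d q : 𝕜} (hq : ‖q‖ < 1) (ha : ‖a‖ < 1)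
    (hb : ‖b‖ < 1) (hc : ‖c‖ < 1) (hd : ‖d‖ < 1) :
    awConst (a * q) b c d q = awConst a b c d q *
      ((1 - a * b) * (1 - a * c) * (1 - a * d) / (1 - a * b * c * d)) := by
  have hab := norm_mul_lt_one ha hb
  have hac := norm_mul_lt_one ha hc
  have had := norm_mul_lt_one ha hd
  have hP := norm_mul_lt_one (norm_mul_lt_one hab hc) hd
  have haq := norm_mul_lt_one ha hq
  have n1 := one_sub_ne_zero_of_norm_lt_one hab
  have n2 := one_sub_ne_zero_of_norm_lt_one hac
  have n3 := one_sub_ne_zero_of_norm_lt_one had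
  have n4 := one_sub_ne_zero_of_norm_lt_one hP
  have n5 := pairProd_ne_zero hq haq hb hc hd
  simp only [pairProd, mul_ne_zero_iff] at n5
  obtain ⟨⟨⟨⟨⟨m1, m2⟩, m3⟩, m4⟩, m5⟩, m6⟩ := n5
  simp only [awConst, pairProd]
  rw [qPochInf_eq_one_sub_mul (a * b) hq, qPochInf_eq_one_sub_mul (a * c) hq,
    qPochInf_eq_one_sub_mul (a * d) hq, qPochInf_eq_one_sub_mul (a * b * c * d) hq,
    show a * b * q = a * q * b by ring, show a * c * q = a * q * c by ring,
    show a * d * q = a * q * d by ring, show a * b * c * d * q = a * q * b * c * d by ring]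
  generalize 1 - a * b = D1 at *
  generalize 1 - a * c = D2 at *
  generalize 1 - a * d = D3 at *
  generalize 1 - a * b * c * d = D4 at *
  generalize qPochInf (a * q * b) q = E1 at *
  generalize qPochInf (a * q * c) q = E2 at *
  generalize qPochInf (a * q * d) q = E3 at *
  field_simp

/-- Multiplying by `φ_c` introduces the parameter `c` into the moments. -/
lemma moment_phiH_mul_step {𝕜 : Type*} [RCLike 𝕜] {g : ℝ → 𝕜}
    (hg : ContinuousOn g (Set.Icc (-1) 1)) {q : ℝ} (hq : |q| < 1) {a b d : 𝕜} (ha : ‖a‖ < 1)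
    (hb : ‖b‖ < 1) (hd : ‖d‖ < 1)
    (hgm : ∀ n, moment q g n = awConst a b 0 d (q : 𝕜) * sigma4 a b 0 d (q : 𝕜) n)
    (n : ℕ) (c : 𝕜) (hc : ‖c‖ < 1) : moment q (fun x => phiH x c q * g x) n =
      awConst a b c d (q : 𝕜) * sigma4 a b c d (q : 𝕜) n := by
  have hq1 : ‖(q : 𝕜)‖ < 1 := norm_ofReal_lt_one hq
  have hq' := qPoch_ne_zero hq1 hq1
  -- the contiguous relation, known in the first parameter, is used in the third one by symmetry
  refine moment_phiH_mul_eq hg hq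
    (fun c n => awConst a b c d (q : 𝕜) * sigma4 a b c d (q : 𝕜) n) ?_ hgm ?_ n c hc
  · intro c hc
    have h := tsum_sigma4_third_zero hq1 ha hb hc hd
    simp only [hgm, sigma4_zero hq', mul_one]
    calc _ = ∑' j, awConst a b 0 d (q : 𝕜) * (sigma4 a b 0 d (q : 𝕜) j * c ^ j / qPoch (q : 𝕜) q j)
          := tsum_congr fun j => by ring
      _ = _ := by
        rw [tsum_mul_left, h]
        simp only [awConst, pairProd, mul_zero, zero_mul, qPochInf_zero, mul_one]
        ring
  · intro c hc n
    have h := sigma4_mul_q hq' c d a b (fun n => one_sub_mul_pow_ne_zero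
      (norm_mul_lt_one (norm_mul_lt_one (norm_mul_lt_one hc hd) ha) hb) hq1 n) n
    simp only [sigma4_comm hq' a b _ d, awConst_comm a b _ d]
    rw [awConst_mul_q hq1 hc hd ha hb]
    linear_combination awConst c d a b (q : 𝕜) * h

lemma moment_fH {𝕜 : Type*} [RCLike 𝕜] {q : ℝ} (hq : |q| < 1) (n : ℕ) :
    moment q (fun x => ((fH x q : ℝ) : 𝕜)) n = if n = 0 then 1 else 0 := by
  have h := congrArg (fun y : ℝ => (y : 𝕜)) (integral_qHermite_mul_fH hq n)
  beta_reduce at h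
  rw [← RCLike.intervalIntegral_ofReal] at h
  rw [moment]
  split_ifs at h ⊢ <;> simpa using h

/-- The moments of the Askey–Wilson weight. The parameters enter in the order `b, d, a, c`; between
two steps, `σ⁽⁴⁾` with vanishing parameters is rewritten by its symmetries. -/
theorem moment_four {𝕜 : Type*} [RCLike 𝕜] {q : ℝ} (hq : |q| < 1) {a b c d : 𝕜} (ha : ‖a‖ < 1)
    (hb : ‖b‖ < 1) (hc : ‖c‖ < 1) (hd : ‖d‖ < 1) (n : ℕ) :
    moment q (fun x => phiH x c q * (phiH x a q * (phiH x d q *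
      (phiH x b q * ((fH x q : ℝ) : 𝕜))))) n =
      awConst a b c d (q : 𝕜) * sigma4 a b c d (q : 𝕜) n := by
  have hq1 : ‖(q : 𝕜)‖ < 1 := norm_ofReal_lt_one hq
  have hq' := qPoch_ne_zero hq1 hq1
  have h00 : ‖(0 : 𝕜)‖ < 1 := by simp
  have c0 : ContinuousOn (fun x => ((fH x q : ℝ) : 𝕜)) (Set.Icc (-1) 1) :=
    RCLike.continuous_ofReal.comp_continuousOn (continuousOn_fH hq)
  have m0 (n : ℕ) : moment q (fun x => ((fH x q : ℝ) : 𝕜)) n =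
      awConst 0 0 0 0 (q : 𝕜) * sigma4 0 0 0 0 (q : 𝕜) n := by
    rw [moment_fH hq, sigma4_first_third_zero hq', S2_eq_qConv hq']
    have := qConv_zero_pow hq' (fun _ => 1) rfl (fun k => (0 : 𝕜) ^ k) n
    simp only [one_mul] at this
    rw [this]
    simp [awConst, pairProd, qPochInf_zero, zero_pow_eq]
  have m1 (n : ℕ) := moment_phiH_mul_step c0 hq h00 h00 h00 m0 n b hb
  have c1 := continuousOn_phiH_mul c0 hb hq
  have m2 (n : ℕ) := moment_phiH_mul_step c1 hq h00 hb h00 (fun n => by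
    rw [m1, sigma4_comm hq', sigma4_second_third_zero hq', sigma4_first_third_zero hq']
    simp [awConst, pairProd, qPochInf_zero]) n d hd
  have c2 := continuousOn_phiH_mul c1 hd hq
  have m3 (n : ℕ) := moment_phiH_mul_step c2 hq h00 hd hb (fun n => by
    rw [m2, sigma4_comm hq', sigma4_second_third_zero hq', sigma4_first_third_zero hq']
    simp [awConst, pairProd, qPochInf_zero, mul_comm]) n a ha
  have c3 := continuousOn_phiH_mul c2 ha hq
  exact moment_phiH_mul_step c3 hq ha hb hd (fun n => by
    rw [m3, sigma4_comm hq', awConst_comm]) n c hc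

/-! ### The product form of the weight -/

lemma multipliable_v {𝕜 : Type*} [RCLike 𝕜] {t : 𝕜} (ht : ‖t‖ < 1) {q : ℝ} (hq : |q| < 1)
    {x : ℝ} (hx : x ∈ Set.Icc (-1 : ℝ) 1) : Multipliable fun k : ℕ => v x (t * (q : 𝕜) ^ k) := by
  have hq1 : ‖(q : 𝕜)‖ < 1 := norm_ofReal_lt_one hq
  have hx1 : ‖(x : 𝕜)‖ ≤ 1 := by simpa [abs_le] using hx
  have h := multipliable_one_add_of_summable
    (f := fun k : ℕ => t * (q : 𝕜) ^ k * (t * (q : 𝕜) ^ k - 2 * (x : 𝕜))) ?_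
  · refine h.congr fun k => ?_
    rw [v]; ring
  · refine Summable.of_nonneg_of_le (fun _ => norm_nonneg _) (fun k => ?_)
      ((summable_geometric_of_lt_one (norm_nonneg (q : 𝕜)) hq1).mul_right 3)
    have h1 : ‖t * (q : 𝕜) ^ k‖ ≤ ‖(q : 𝕜)‖ ^ k := by
      rw [norm_mul, norm_pow]
      exact mul_le_of_le_one_left (by positivity) ht.le
    have h2 : ‖t * (q : 𝕜) ^ k - 2 * (x : 𝕜)‖ ≤ 3 := by
      refine (norm_sub_le _ _).trans ?_
      have := (norm_mul_pow_lt_one ht hq1 k).le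
      rw [norm_mul 2, RCLike.norm_ofNat]
      linarith
    rw [norm_mul]
    exact mul_le_mul h1 h2 (norm_nonneg _) (by positivity)

/-- The product formula `φ_h(x|t) = ∏ 1 / v(x|t qᵏ)`. -/
lemma hasProd_inv_v {𝕜 : Type*} [RCLike 𝕜] {t : 𝕜} (ht : ‖t‖ < 1) {q : ℝ} (hq : |q| < 1)
    {x : ℝ} (hx : x ∈ Set.Icc (-1 : ℝ) 1) :
    HasProd (fun k : ℕ => (v x (t * (q : 𝕜) ^ k))⁻¹) (phiH x t q) := by
  have h := multipliable_v ht hq hx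
  have e : (∏' k : ℕ, v x (t * (q : 𝕜) ^ k)) * phiH x t q = 1 :=
    tendsto_nhds_unique (h.tendsto_prod_tprod_nat.mul_const _) (tendsto_prod_v_mul_phiH ht hq hx)
  have h0 := left_ne_zero_of_mul_eq_one e
  rw [← inv_eq_of_mul_eq_one_right e]
  exact h.hasProd.inv₀ h0

lemma awIntegrand_eq {𝕜 : Type*} [RCLike 𝕜] {q : ℝ} (hq : |q| < 1) {a b c d : 𝕜} (ha : ‖a‖ < 1)
    (hb : ‖b‖ < 1) (hc : ‖c‖ < 1) (hd : ‖d‖ < 1) {x : ℝ} (hx : x ∈ Set.Icc (-1 : ℝ) 1) :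
    awIntegrand x a b c d q = ((2 * Real.pi : ℝ) : 𝕜) / qPochInf (q : 𝕜) q *
      (phiH x c q * (phiH x a q * (phiH x d q * (phiH x b q * ((fH x q : ℝ) : 𝕜))))) := by
  have hl : HasProd (fun k : ℕ => ((l x (q ^ k) : ℝ) : 𝕜))
      ((4 * (1 - x ^ 2) * ∏' k : ℕ, l x (q ^ (k + 1)) : ℝ) : 𝕜) := by
    rw [← tprod_l_eq hq hx]
    exact (multipliable_l hq hx).hasProd.map (algebraMap ℝ 𝕜) RCLike.continuous_ofReal
  have hprod := hl.mul ((((hasProd_inv_v ha hq hx).mul (hasProd_inv_v hb hq hx)).mul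
    (hasProd_inv_v hc hq hx)).mul (hasProd_inv_v hd hq hx))
  have e := hprod.tprod_eq
  simp only [← mul_inv] at e
  simp only [← div_eq_mul_inv] at e
  have hq1 : ‖q‖ < 1 := hq
  have hne := qPochInf_ne_zero hq1 hq1
  -- at `x = ± 1` both sides of the following identity vanish, since `1 / √0 = 0`
  have hs : 1 / Real.sqrt (1 - x ^ 2) * (4 * (1 - x ^ 2) * ∏' k : ℕ, l x (q ^ (k + 1))) =
      2 * Real.pi / qPochInf q q * fH x q := by
    have h1 : 1 / Real.sqrt (1 - x ^ 2) * (1 - x ^ 2) = Real.sqrt (1 - x ^ 2) := by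
      rw [one_div_mul_eq_div, Real.div_sqrt]
    rw [fH]
    have := Real.pi_ne_zero
    field_simp at h1 ⊢
    linear_combination (4 * ∏' k : ℕ, l x (q ^ (k + 1))) * h1
  have hs' := congrArg (fun y : ℝ => (y : 𝕜)) hs
  rw [awIntegrand, e, ← ofReal_qPochInf q hq]
  push_cast at hs' ⊢
  linear_combination (phiH x a q * phiH x b q * phiH x c q * phiH x d q) * hs'

end AskeyWilson

end

theorem mainTheorem2 {𝕜 : Type*} [RCLike 𝕜] (q : ℝ) (hq : |q| < 1) (a b c d : 𝕜)
    (ha : ‖a‖ < 1) (hb : ‖b‖ < 1) (hc : ‖c‖ < 1) (hd : ‖d‖ < 1) :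
    (∀ n : ℕ,
      IntervalIntegrable
        (fun x : ℝ => ((AskeyWilson.qHermite x q n : ℝ) : 𝕜) * AskeyWilson.fAW x a b c d q)
        volume (-1) 1 ∧
      ∫ x in (-1 : ℝ)..1, ((AskeyWilson.qHermite x q n : ℝ) : 𝕜) * AskeyWilson.fAW x a b c d q
        = AskeyWilson.sigma4 a b c d (q : 𝕜) n) ∧
    (∫ x in (-1 : ℝ)..1, AskeyWilson.fAW x a b c d q = 1) ∧
    IntervalIntegrable (fun x : ℝ => AskeyWilson.awIntegrand x a b c d q) volume (-1) 1 ∧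
    ((1 / (2 * Real.pi) : ℝ) : 𝕜) * ∫ x in (-1 : ℝ)..1, AskeyWilson.awIntegrand x a b c d q
      = AskeyWilson.qPochInf (a * b * c * d) (q : 𝕜) /
          (AskeyWilson.qPochInf (q : 𝕜) (q : 𝕜) *
            AskeyWilson.pairProd a b c d (q : 𝕜)) := by
  open AskeyWilson in
  have hq1 : ‖(q : 𝕜)‖ < 1 := norm_ofReal_lt_one hq
  have hC := awConst_ne_zero hq1 ha hb hc hd
  set W : ℝ → 𝕜 := fun x => phiH x c q * (phiH x a q * (phiH x d q *
    (phiH x b q * ((fH x q : ℝ) : 𝕜)))) with hW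
  have cW : ContinuousOn W (Set.Icc (-1) 1) :=
    continuousOn_phiH_mul (continuousOn_phiH_mul (continuousOn_phiH_mul (continuousOn_phiH_mul
      (RCLike.continuous_ofReal.comp_continuousOn (continuousOn_fH hq)) hb hq) hd hq) ha hq) hc hq
  have hf (x : ℝ) : fAW x a b c d q = (awConst a b c d (q : 𝕜))⁻¹ * W x := by
    rw [fAW, awConst, inv_div, hW]; ring
  have moments (n : ℕ) : IntervalIntegrable
        (fun x : ℝ => ((qHermite x q n : ℝ) : 𝕜) * fAW x a b c d q) volume (-1) 1 ∧
      ∫ x in (-1 : ℝ)..1, ((qHermite x q n : ℝ) : 𝕜) * fAW x a b c d q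
        = sigma4 a b c d (q : 𝕜) n := by
    simp only [hf, mul_left_comm _ (awConst a b c d (q : 𝕜))⁻¹]
    refine ⟨(intervalIntegrable_of_continuousOn_Icc
      (continuousOn_qHermite_mul cW q n)).const_mul _, ?_⟩
    have h := moment_four hq ha hb hc hd n
    rw [moment] at h
    rw [intervalIntegral.integral_const_mul, h, inv_mul_cancel_left₀ hC]
  have hAW : Set.EqOn (fun x => awIntegrand x a b c d q)
      (fun x => ((2 * Real.pi : ℝ) : 𝕜) / qPochInf (q : 𝕜) q * W x) (Set.uIcc (-1) 1) := by
    intro x hx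
    rw [Set.uIcc_of_le (by norm_num)] at hx
    exact awIntegrand_eq hq ha hb hc hd hx
  refine ⟨moments, ?_, ?_, ?_⟩
  · have h := (moments 0).2
    rw [sigma4_zero (qPoch_ne_zero hq1 hq1)] at h
    simpa [qHermite] using h
  · exact ((intervalIntegrable_of_continuousOn_Icc cW).const_mul _).congr
      (hAW.symm.mono Set.uIoc_subset_uIcc)
  · have h := moment_four hq ha hb hc hd 0
    rw [moment, sigma4_zero (qPoch_ne_zero hq1 hq1), mul_one] at h
    simp only [qHermite, RCLike.ofReal_one, one_mul] at h
    rw [intervalIntegral.integral_congr hAW, intervalIntegral.integral_const_mul, h, awConst]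
    have h1 := qPochInf_ne_zero hq1 hq1
    have h2 := pairProd_ne_zero hq1 ha hb hc hd
    have h3 : (Real.pi : 𝕜) ≠ 0 := by exact_mod_cast Real.pi_ne_zero
    push_cast
    field_simp
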